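/- Let $J$ be a measurable kernel on $\mathbb{R}^N\times\mathbb{R}^N$ with $J(x,y)=J(y,x)\ge 0$ for $x\ne y$ and $\sup_{x}\int_{\mathbb{R}^N}J(x,y)\min\{1,|x-y|^2\}\,dy<\infty$. Let $$\mathcal{E}(f,g)=\frac12\iint (f(x)-f(y))(g(x)-g(y))J(x,y)\,dx\,dy,\qquad H_{\mathcal L}=\{f\in L^2(\mathbb{R}^N):\mathcal{E}(f,f)<\infty\},$$ and let $\mathcal{L}$ be the associated operator, $\langle\mathcal{L}f,g\rangle=\mathcal{E}(f,g)$. For $u_0\in L^2(\mathbb{R}^N)$, the (mild) solution of $\partial_tu+\mathcal{L}u=0$, $u(0)=u_0$, is the function $u\in C([0,\infty);L^2)\cap C^1((0,\infty);L^2)\cap C((0,\infty);H_{\mathcal L})$ with $u(0)=u_0$ and $\langle u'(t),g\rangle+\mathcal{E}(u(t),g)=0$ for all $t>0$ and $g\in H_{\mathcal L}$. Fix $p\ge2$. Assume that for every $r\ge p$ the $r$-logarithmic Sobolev inequality holds with constants $C(r)\in\mathbb{R}$, $D(r)>0$: $$\mathrm{Ent}(|f|^r)\le C(r)\|f\|_r^r+D(r)\,\mathcal{E}(|f|^{r-2}f,f)\qquad\text{for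 all real measurable } f \text{ with } |f|^{r/2}\in H_{\mathcal L},$$ where $\mathrm{Ent}(g)=\int\Phi(|g|)-\Phi\big(\int|g|\big)$, $\Phi(s)=s\log s$, $\Phi(0)=0$ (entropy and energy take extended real values; no condition is imposed on $f$ if the entropy is undefined, of the form $\infty-\infty$). Assume that $$\int_p^\infty\frac{D(\alpha)}{\alpha^2}\,d\alpha<\infty\qquad\text{and}\qquad\int_p^\infty\frac{C(\alpha)}{\alpha^2}\,d\alpha<\infty,$$ where $D$ is measurable, $C$ is locally integrable on $[p,\infty)$, and the second condition is understood as $\sup_{R\ge p}\int_p^R\frac{C(\alpha)}{\alpha^2}\,d\alpha<\infty$ (in particular it holds if $C(\alpha)/\alpha^2$ is integrable on $(p,\infty)$, or if its improper integral converges). Then $\mathcal{L}$ is eventually ultracontractive: there are $t_0\in(0,\infty)$ and a function $B\ge0$ on $[t_0,\infty)$ such that, for every $u_0\in L^2(\mathbb{R}^N)$, the solution $u$ satisfies $$\|u(t)\|_\infty\le B(t)\,\|u_0\|_2\qquad\text{for all } t\ge t_0.$$ -/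

import Mathlib

open scoped ENNReal NNReal

noncomputable section

namespace LevyOp

/-- The space `ℝ^N` with its Euclidean norm and Lebesgue measure. -/
abbrev Space (N : ℕ) : Type := EuclideanSpace ℝ (Fin N)

/-- The real Hilbert space `L²(ℝ^N)`. -/
abbrev L2 (N : ℕ) : Type :=
  MeasureTheory.Lp ℝ 2 (MeasureTheory.volume : MeasureTheory.Measure (Space N))

/-- The Lebesgue integral with values in `[-∞, ∞]`: integral of the positive part minus integral of
the negative part. It is the usual integral for an integrable function. In the undefined case
`∞ - ∞` the value is `-∞`. -/
def extIntegral {X : Type*} [MeasurableSpace X] (μ : MeasureTheory.Measure X) (h : X → ℝ) : EReal :=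
  ((∫⁻ x, ENNReal.ofReal (h x) ∂μ : ℝ≥0∞) : EReal) -
    ((∫⁻ x, ENNReal.ofReal (-h x) ∂μ : ℝ≥0∞) : EReal)

/-- Symmetric nonnegative Lévy kernels on `ℝ^N`. Values on the diagonal play no role. -/
structure IsLevyKernel {N : ℕ} (J : Space N → Space N → ℝ) : Prop where
  measurable : Measurable (Function.uncurry J)
  nonneg : ∀ x y, x ≠ y → 0 ≤ J x y
  symm : ∀ x y, x ≠ y → J x y = J y x
  levy : (⨆ x, ∫⁻ y, ENNReal.ofReal (J x y * min 1 (‖x - y‖ ^ 2))) < ∞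

/-- The Dirichlet form `𝓔(f, g) = ½ ∬ (f(x) - f(y)) (g(x) - g(y)) J(x, y) dx dy`, as an extended
real number. It is finite for `f`, `g` in the energy space; if the integrand is nonnegative it is
always meaningful, possibly `∞`. -/
def dirichletForm {N : ℕ} (J : Space N → Space N → ℝ) (f g : Space N → ℝ) : EReal :=
  extIntegral ((MeasureTheory.volume : MeasureTheory.Measure (Space N)).prod MeasureTheory.volume)
    (fun z => 1 / 2 * ((f z.1 - f z.2) * (g z.1 - g z.2) * J z.1 z.2))

/-- Membership in the energy space `H_𝓛(ℝ^N) = {f ∈ L² : 𝓔(f, f) < ∞}`. -/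
def MemEnergySpace {N : ℕ} (J : Space N → Space N → ℝ) (f : Space N → ℝ) : Prop :=
  MeasureTheory.MemLp f 2 MeasureTheory.volume ∧ dirichletForm J f f < ⊤

/-- `u` is the (mild) solution of `∂ₜu + 𝓛u = 0`, `u(0) = u₀`:
`u ∈ C([0,∞); L²) ∩ C¹((0,∞); L²) ∩ C((0,∞); H_𝓛)`, and the equation holds in `L²` at all `t > 0`,
where `𝓛` is given by `⟨𝓛f, g⟩ = 𝓔(f, g)` for all `g ∈ H_𝓛`. -/
structure IsMildSolution {N : ℕ} (J : Space N → Space N → ℝ) (u₀ : L2 N) (u : ℝ → L2 N) :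
    Prop where
  initial : u 0 = u₀
  continuousOn : ContinuousOn u (Set.Ici 0)
  contDiffOn : ContDiffOn ℝ 1 u (Set.Ioi 0)
  mem_energySpace : ∀ t, 0 < t → MemEnergySpace J (u t)
  /-- Continuity for the energy seminorm; with continuity in `L²` this is continuity in `H_𝓛`. -/
  continuous_energy : ∀ t, 0 < t →
    Filter.Tendsto (fun s => dirichletForm J ⇑(u s - u t) ⇑(u s - u t)) (nhds t) (nhds 0)
  equation : ∀ t, 0 < t → ∀ g : L2 N, MemEnergySpace J g →
    ((inner ℝ (deriv u t) g : ℝ) : EReal) + dirichletForm J (u t) g = 0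

/-- `𝓛` is eventually ultracontractive: there are `0 < t₀ < ∞` and `B(t) ≥ 0` such that
`‖u(t)‖_∞ ≤ B(t) ‖u₀‖₂` for all `t ≥ t₀` and all solutions `u` with initial datum `u₀ ∈ L²`. -/
def EventuallyUltracontractive {N : ℕ} (J : Space N → Space N → ℝ) : Prop :=
  ∃ t₀ : ℝ, 0 < t₀ ∧ ∃ B : ℝ → ℝ≥0, ∀ (u₀ : L2 N) (u : ℝ → L2 N), IsMildSolution J u₀ u →
    ∀ t, t₀ ≤ t →
      MeasureTheory.eLpNorm (u t) ∞ MeasureTheory.volume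
        ≤ (B t : ℝ≥0∞) * MeasureTheory.eLpNorm u₀ 2 MeasureTheory.volume

/-- `Φ(s) = s log s`, with `Φ(0) = 0`. -/
def Phi (s : ℝ) : ℝ := s * Real.log s

/-- The entropy `Ent(f) = ∫ Φ(|f|) - Φ(∫ |f|)` of an integrable function `f`, a number in
`[-∞, ∞]`. -/
def entropy {N : ℕ} (f : Space N → ℝ) : EReal :=
  extIntegral MeasureTheory.volume (fun x => Phi |f x|) - ((Phi (∫ x, |f x|) : ℝ) : EReal)

/-- The `r`-logarithmic Sobolev inequality with constants `C ∈ ℝ` and `D > 0`: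
`Ent(|f|^r) ≤ C ‖f‖_r^r + D 𝓔(|f|^(r-2) f, f)` whenever `|f|^(r/2) ∈ H_𝓛`. Such `f` are in `L^r`,
and `𝓔(|f|^(r-2) f, f)` has a nonnegative integrand. -/
def LogSobolev {N : ℕ} (J : Space N → Space N → ℝ) (r C D : ℝ) : Prop :=
  0 < D ∧ ∀ f : Space N → ℝ, Measurable f → MemEnergySpace J (fun x => |f x| ^ (r / 2)) →
    entropy (fun x => |f x| ^ r) ≤
      ((C * ∫ x, |f x| ^ r : ℝ) : EReal) +
        (D : EReal) * dirichletForm J (fun x => |f x| ^ (r - 2) * f x) f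

end LevyOp

end

/-! The proof is Gross' argument. Put `d r = D r / r²` and `c r = C r / r²`, and let a solution `V`
run along a time path `τ` with `τ' = d`. The derivative of `Λ(r) = log (∫ |V(τ r)|^r) / r` contains
the entropy, the term `-log (∫ |V|^r) / r²` and minus `d r` times the energy of order `r`. With this
velocity the logarithmic Sobolev inequality of order `r` cancels the energy and leaves `Λ' ≤ c`.
Since `∫ d` is finite, `r` reaches infinity in finite time; since the integrals of `c` are bounded
above, the `L^r` norms stay below a fixed multiple of the initial `L²` norm, hence so does the
essential supremum.

The path has to start at order 2, while the hypothesis begins at `p`. For `2 < r ≤ p` the inequality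
of order `p` is applied to `|w|^(r/p)`; the Stroock–Varopoulos inequality
(`sq_abs_rpow_half_sub_le`) brings the energy back to that of `w`, at the price of a factor `p²/4`
(`LogSobolev.real_of_le`).

Differentiating `∫ |V|^r` in `r` and in time needs `|V| ≤ 1`, `r > 2` and a bounded time derivative.
An arbitrary solution has none of these bounds, so the argument is run on auxiliary ones. The
operator is handled through the closed graph of the increment map. Yosida approximation gives strong
solutions from data in the domain of the squared operator (`exists_solution`), and truncation
arguments keep them bounded (`ae_abs_le_of_formRel`). Such data approximate `u(δ)` in `L²`, and the
final estimate involves only the `L²` norm. It therefore passes to `u(δ + T)` by contractivity and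
almost everywhere convergence (`IsMildSolution.ae_abs_le`). As `d` is only integrable, `τ` and `Λ`
are absolutely continuous, and `Λ' ≤ c` is used almost everywhere. -/

noncomputable section

namespace LevyOp

open scoped InnerProductSpace Topology
open Filter Set MeasureTheory

/-! ### Operators of closed forms in Hilbert space and their resolvents. -/

section Hilbert

variable {X G : Type*} [NormedAddCommGroup X] [InnerProductSpace ℝ X]
  [NormedAddCommGroup G] [InnerProductSpace ℝ G]

/-- For the graph `Γ` of a gradient, the (possibly multivalued) operator given by the weak
formulation `⟨y, g⟩ = ⟨∇x, ∇g⟩`. -/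
def FormRel (Γ : Submodule ℝ (X × G)) (x y : X) : Prop :=
  ∃ ρ : G, (x, ρ) ∈ Γ ∧ ∀ z ∈ Γ, ⟪y, z.1⟫_ℝ = ⟪ρ, z.2⟫_ℝ

namespace FormRel

variable {Γ : Submodule ℝ (X × G)} {x x' y y' : X}

theorem sub (h : FormRel Γ x y) (h' : FormRel Γ x' y') : FormRel Γ (x - x') (y - y') := by
  obtain ⟨ρ, hρ, h1⟩ := h
  obtain ⟨ρ', hρ', h2⟩ := h'
  refine ⟨ρ - ρ', Γ.sub_mem hρ hρ', fun z hz => ?_⟩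
  rw [inner_sub_left, inner_sub_left, h1 z hz, h2 z hz]

theorem smul (c : ℝ) (h : FormRel Γ x y) : FormRel Γ (c • x) (c • y) := by
  obtain ⟨ρ, hρ, h1⟩ := h
  refine ⟨c • ρ, Γ.smul_mem c hρ, fun z hz => ?_⟩
  rw [real_inner_smul_left, real_inner_smul_left, h1 z hz]

theorem inner_nonneg (h : FormRel Γ x y) : 0 ≤ ⟪y, x⟫_ℝ := by
  obtain ⟨ρ, hρ, h1⟩ := h
  rw [h1 _ hρ]
  exact real_inner_self_nonneg

theorem eq_zero_of_pos {h : ℝ} (hh : 0 < h) (hA : FormRel Γ x (-(h⁻¹ • x))) : x = 0 := by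
  have := hA.inner_nonneg
  rw [inner_neg_left, real_inner_smul_left, real_inner_self_eq_norm_sq] at this
  have h1 : 0 < h⁻¹ := inv_pos.2 hh
  have : ‖x‖ ^ 2 ≤ 0 := by nlinarith
  simpa using this

/-- The operator of a closed form is closed. -/
theorem of_tendsto [CompleteSpace G] (hΓ : IsClosed (Γ : Set (X × G))) {a b : ℕ → X}
    (hA : ∀ n, FormRel Γ (a n) (b n)) (ha : Tendsto a atTop (𝓝 x)) (hb : Tendsto b atTop (𝓝 y)) :
    FormRel Γ x y := by
  choose ρ hρ h1 using hA
  -- Testing the weak equation with the difference `a m - a n` itself makes the gradients Cauchy,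
  -- from the convergence of `a` and `b` alone.
  have key : ∀ m n, ‖ρ m - ρ n‖ ^ 2 = ⟪b m - b n, a m - a n⟫_ℝ := by
    intro m n
    have hmem : (a m - a n, ρ m - ρ n) ∈ Γ := Γ.sub_mem (hρ m) (hρ n)
    rw [inner_sub_left, h1 m _ hmem, h1 n _ hmem, ← inner_sub_left, real_inner_self_eq_norm_sq]
  have hc : CauchySeq ρ := by
    rw [Metric.cauchySeq_iff']
    intro ε hε
    obtain ⟨N₁, hN₁⟩ := Metric.cauchySeq_iff.1 ha.cauchySeq ε hε
    obtain ⟨N₂, hN₂⟩ := Metric.cauchySeq_iff.1 hb.cauchySeq ε hε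
    refine ⟨max N₁ N₂, fun n hn => ?_⟩
    have e1 := hN₁ n ((le_max_left _ _).trans hn) _ (le_max_left N₁ N₂)
    have e2 := hN₂ n ((le_max_right _ _).trans hn) _ (le_max_right N₁ N₂)
    rw [dist_eq_norm] at e1 e2 ⊢
    have e3 := real_inner_le_norm (b n - b (max N₁ N₂)) (a n - a (max N₁ N₂))
    rw [← key] at e3
    refine lt_of_pow_lt_pow_left₀ 2 hε.le (e3.trans_lt ?_)
    rw [sq]
    exact mul_lt_mul'' e2 e1 (norm_nonneg _) (norm_nonneg _)
  obtain ⟨σ, hσ⟩ := cauchySeq_tendsto_of_complete hc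
  refine ⟨σ, hΓ.mem_of_tendsto (ha.prodMk_nhds hσ) (Eventually.of_forall hρ), fun z hz => ?_⟩
  refine tendsto_nhds_unique (hb.inner tendsto_const_nhds) ?_
  simp_rw [h1 _ z hz]
  exact hσ.inner tendsto_const_nhds

end FormRel

/-- The resolvent `(1 + h A)⁻¹` of a closed form. -/
theorem exists_resolvent [CompleteSpace X] [CompleteSpace G] (Γ : Submodule ℝ (X × G))
    (hΓ : IsClosed (Γ : Set (X × G))) {h : ℝ} (hh : 0 < h) :
    ∃ R : X →L[ℝ] X, ∀ f, FormRel Γ (R f) (h⁻¹ • (f - R f)) := by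
  -- The resolvent minimizes `‖f - x‖² + h ‖∇x‖²`: it is the first component of the orthogonal
  -- projection of `(f, 0)` onto the graph with gradients rescaled by `√h`.
  let s : ℝ := √h
  have hs : 0 < s := Real.sqrt_pos.2 hh
  have hs2 : s * s = h := Real.mul_self_sqrt hh.le
  let T : WithLp 2 (X × G) →L[ℝ] X × G :=
    ((ContinuousLinearMap.fst ℝ X G).prod (s⁻¹ • ContinuousLinearMap.snd ℝ X G)).comp
      (WithLp.prodContinuousLinearEquiv 2 ℝ X G).toContinuousLinearMap
  let Γ' : Submodule ℝ (WithLp 2 (X × G)) := Γ.comap T.toLinearMap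
  have hcl : IsClosed (Γ' : Set (WithLp 2 (X × G))) := hΓ.preimage T.continuous
  have : CompleteSpace Γ' := hcl.completeSpace_coe
  let ι : X →L[ℝ] WithLp 2 (X × G) :=
    (WithLp.prodContinuousLinearEquiv 2 ℝ X G).symm.toContinuousLinearMap.comp
      (ContinuousLinearMap.inl ℝ X G)
  let π : WithLp 2 (X × G) →L[ℝ] X := (ContinuousLinearMap.fst ℝ X G).comp
      (WithLp.prodContinuousLinearEquiv 2 ℝ X G).toContinuousLinearMap
  refine ⟨π.comp (Γ'.starProjection.comp ι), fun f => ?_⟩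
  set z : WithLp 2 (X × G) := Γ'.starProjection (ι f) with hz
  have hzm : z ∈ Γ' := Submodule.starProjection_apply_mem _ _
  refine ⟨s⁻¹ • z.snd, hzm, fun w hw => ?_⟩
  let w' : WithLp 2 (X × G) := WithLp.toLp 2 (w.1, s • w.2)
  have hw' : w' ∈ Γ' := by
    change (w.1, s⁻¹ • s • w.2) ∈ Γ
    rw [inv_smul_smul₀ hs.ne']
    exact hw
  have horth : ⟪ι f - z, w'⟫_ℝ = 0 := Submodule.starProjection_inner_eq_zero _ _ hw'
  rw [WithLp.prod_inner_apply] at horth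
  have e1 : ⟪f - z.fst, w.1⟫_ℝ + ⟪(0 : G) - z.snd, s • w.2⟫_ℝ = 0 := horth
  have e2 : (π.comp (Γ'.starProjection.comp ι)) f = z.fst := rfl
  rw [e2]
  rw [zero_sub, inner_neg_left, real_inner_smul_right] at e1
  rw [real_inner_smul_left, real_inner_smul_left]
  have e3 : ⟪f - z.fst, w.1⟫_ℝ = s * ⟪z.snd, w.2⟫_ℝ := by linarith
  rw [e3, ← hs2]
  field_simp

end Hilbert

/-! ### Yosida approximation and existence of strong solutions. -/

section Yosida

variable {X G : Type*} [NormedAddCommGroup X] [InnerProductSpace ℝ X]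
  [NormedAddCommGroup G] [InnerProductSpace ℝ G]

/-- The Yosida approximation `h⁻¹ (1 - R)` attached to a resolvent `R = (1 + h A)⁻¹`. -/
def yosida (R : X →L[ℝ] X) (h : ℝ) : X →L[ℝ] X := h⁻¹ • (1 - R)

/-- `R` is the resolvent `(1 + h A)⁻¹` of the operator of the form `Γ`. -/
def IsResolvent (Γ : Submodule ℝ (X × G)) (h : ℝ) (R : X →L[ℝ] X) : Prop :=
  0 < h ∧ ∀ f, FormRel Γ (R f) (yosida R h f)

theorem yosida_apply (R : X →L[ℝ] X) (h : ℝ) (x : X) : yosida R h x = h⁻¹ • (x - R x) := rfl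

namespace IsResolvent

variable {Γ : Submodule ℝ (X × G)} {h : ℝ} {R : X →L[ℝ] X}

theorem sub_apply (hR : IsResolvent Γ h R) (x : X) : x - R x = h • yosida R h x := by
  rw [yosida_apply, smul_inv_smul₀ hR.1.ne']

theorem apply_eq (hR : IsResolvent Γ h R) (x : X) : R x = x - h • yosida R h x := by
  rw [← hR.sub_apply, sub_sub_cancel]

/-- Writing `x = R x + h A_h x`, where `A_h = yosida R h`, splits the product into a form value and
`h ‖A_h x‖²`. -/
theorem inner_yosida_nonneg (hR : IsResolvent Γ h R) (x : X) : 0 ≤ ⟪yosida R h x, x⟫_ℝ := by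
  have h1 := (hR.2 x).inner_nonneg
  rw [hR.apply_eq, inner_sub_right, real_inner_smul_right, real_inner_self_eq_norm_sq] at h1
  have := mul_nonneg hR.1.le (sq_nonneg ‖yosida R h x‖)
  linarith

/-- Accretivity between the pairs `(x, y)` and `(R x, A_h x)` gives `⟪y - A_h x, h A_h x⟫ ≥ 0`;
Cauchy–Schwarz finishes. -/
theorem norm_yosida_le (hR : IsResolvent Γ h R) {x y : X} (hA : FormRel Γ x y) :
    ‖yosida R h x‖ ≤ ‖y‖ := by
  have h1 := (hA.sub (hR.2 x)).inner_nonneg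
  rw [hR.sub_apply, real_inner_smul_right] at h1
  have h2 := nonneg_of_mul_nonneg_right h1 hR.1
  rw [inner_sub_left, real_inner_self_eq_norm_sq] at h2
  have h3 := real_inner_le_norm y (yosida R h x)
  by_contra! hlt
  nlinarith [norm_nonneg y, norm_nonneg (yosida R h x)]

/-- Both sides solve the resolvent equation `(1 + h A) z = y`, whose solution is unique. -/
theorem yosida_eq (hR : IsResolvent Γ h R) {x y : X} (hA : FormRel Γ x y) :
    yosida R h x = R y := by
  have h1 := (hA.sub (hR.2 x))
  rw [hR.sub_apply] at h1
  have h2 := h1.smul h⁻¹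
  rw [inv_smul_smul₀ hR.1.ne'] at h2
  have h3 := h2.sub (hR.2 y)
  rw [← sub_eq_zero]
  refine FormRel.eq_zero_of_pos hR.1 (Γ := Γ) ?_
  convert h3 using 1
  rw [yosida_apply R h y, ← smul_sub, ← smul_neg]
  congr 1
  abel

theorem norm_yosida_sub_le (hR : IsResolvent Γ h R) {x y z : X} (hA : FormRel Γ x y)
    (hA' : FormRel Γ y z) : ‖yosida R h x - y‖ ≤ h * ‖z‖ := by
  rw [hR.yosida_eq hA, ← norm_neg, neg_sub, hR.sub_apply, norm_smul, Real.norm_of_nonneg hR.1.le]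
  exact mul_le_mul_of_nonneg_left (hR.norm_yosida_le hA') hR.1.le

end IsResolvent

variable {Γ : Submodule ℝ (X × G)} {h k : ℝ} {R Q : X →L[ℝ] X}

/-- Solutions are contractive. -/
theorem antitoneOn_norm_of_formRel {v w : ℝ → X} (hv : ContinuousOn v (Ici 0))
    (hd : ∀ t, 0 < t → HasDerivAt v (-w t) t) (hA : ∀ t, 0 < t → FormRel Γ (v t) (w t)) :
    AntitoneOn (fun t => ‖v t‖) (Ici 0) := by
  have h1 : AntitoneOn (fun t => ‖v t‖ ^ 2) (Ici 0) := by
    refine antitoneOn_of_deriv_nonpos (convex_Ici 0) (hv.norm.pow 2) ?_ ?_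
    · rw [interior_Ici]
      exact fun t ht => (hd t ht).norm_sq.differentiableAt.differentiableWithinAt
    · rw [interior_Ici]
      intro t ht
      rw [(hd t ht).norm_sq.deriv, inner_neg_right, real_inner_comm]
      linarith [(hA t ht).inner_nonneg]
  exact fun s hs t ht hst => le_of_sq_le_sq (h1 hs ht hst) (norm_nonneg _)

/-- `R (R w) → w` as `h → 0` for `w` in the form domain. -/
theorem norm_resolvent_sub_sq_le (hR : IsResolvent Γ h R) {w : X} {σ : G} (hw : (w, σ) ∈ Γ) :
    ‖w - R w‖ ^ 2 ≤ h * ‖σ‖ ^ 2 := by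
  obtain ⟨ρ, hρ, h1⟩ := hR.2 w
  have e1 : ⟪yosida R h w, w - R w⟫_ℝ = ⟪ρ, σ - ρ⟫_ℝ := h1 _ (Γ.sub_mem hw hρ)
  rw [hR.sub_apply, real_inner_smul_right, inner_sub_right, real_inner_self_eq_norm_sq,
    real_inner_self_eq_norm_sq] at e1
  rw [hR.sub_apply, norm_smul, Real.norm_of_nonneg hR.1.le]
  have e2 := real_inner_le_norm ρ σ
  have e3 : h * ‖yosida R h w‖ ^ 2 ≤ ‖σ‖ ^ 2 := by
    nlinarith [sq_nonneg (‖ρ‖ - ‖σ‖), sq_nonneg ‖ρ‖, sq_nonneg ‖σ‖]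
  have := mul_le_mul_of_nonneg_left e3 hR.1.le
  nlinarith

theorem norm_resolvent_le (hR : IsResolvent Γ h R) (x : X) : ‖R x‖ ≤ ‖x‖ := by
  have h1 := (hR.2 x).inner_nonneg
  rw [yosida_apply, real_inner_smul_left] at h1
  have h2 := nonneg_of_mul_nonneg_right h1 (inv_pos.2 hR.1)
  rw [inner_sub_left, real_inner_self_eq_norm_sq] at h2
  have h3 := real_inner_le_norm x (R x)
  by_contra! hlt
  nlinarith [norm_nonneg x, norm_nonneg (R x)]

/-- The semigroup generated by a Yosida approximation. -/
def yosidaExp (R : X →L[ℝ] X) (h t : ℝ) : X →L[ℝ] X := NormedSpace.exp (t • (-yosida R h))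

theorem yosidaExp_zero (R : X →L[ℝ] X) (h : ℝ) : yosidaExp R h 0 = 1 := by
  rw [yosidaExp, zero_smul, NormedSpace.exp_zero]

theorem yosidaExp_yosida (R : X →L[ℝ] X) (h t : ℝ) (x : X) :
    yosidaExp R h t (yosida R h x) = yosida R h (yosidaExp R h t x) := by
  have h1 : Commute (yosidaExp R h t) (yosida R h) := by
    refine Commute.exp_left ?_
    exact ((Commute.refl (yosida R h)).neg_left).smul_left t
  exact congrArg (fun T : X →L[ℝ] X => T x) h1.eq

variable [CompleteSpace X]

theorem hasDerivAt_yosidaExp (R : X →L[ℝ] X) (h t : ℝ) (x : X) :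
    HasDerivAt (fun t => yosidaExp R h t x) (-yosida R h (yosidaExp R h t x)) t := by
  have h1 := hasDerivAt_exp_smul_const (𝕂 := ℝ) (-yosida R h) t
  have h2 := h1.clm_apply (hasDerivAt_const t x)
  rw [map_zero, add_zero, mul_neg] at h2
  rw [← yosidaExp_yosida]
  exact h2

theorem norm_yosidaExp_le (hR : IsResolvent Γ h R) {t : ℝ} (ht : 0 ≤ t) (x : X) :
    ‖yosidaExp R h t x‖ ≤ ‖x‖ := by
  have hd : ∀ s, HasDerivAt (fun s => ‖yosidaExp R h s x‖ ^ 2)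
      (2 * ⟪yosidaExp R h s x, -yosida R h (yosidaExp R h s x)⟫_ℝ) s :=
    fun s => (hasDerivAt_yosidaExp R h s x).norm_sq
  have hanti : Antitone (fun s => ‖yosidaExp R h s x‖ ^ 2) := by
    refine antitone_of_deriv_nonpos (fun s => (hd s).differentiableAt) fun s => ?_
    rw [(hd s).deriv, inner_neg_right, real_inner_comm]
    have := hR.inner_yosida_nonneg (yosidaExp R h s x)
    linarith
  have := hanti ht
  simp only [yosidaExp_zero, one_apply_eq_self] at this
  exact le_of_sq_le_sq this (norm_nonneg _)

theorem norm_yosida_yosidaExp_le (hR : IsResolvent Γ h R) {t : ℝ} (ht : 0 ≤ t) {x y : X}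
    (hA : FormRel Γ x y) : ‖yosida R h (yosidaExp R h t x)‖ ≤ ‖y‖ := by
  rw [← yosidaExp_yosida]
  exact (norm_yosidaExp_le hR ht _).trans (hR.norm_yosida_le hA)

/-- Cauchy estimate for the approximate semigroups. With `a`, `b` the two Yosida derivatives, `p - q
= (R p - Q q) + (h a - k b)`. Accretivity gives the first part a favourable sign against `a - b`.
The second contributes at most `2 · 2‖y‖ · (h + k)‖y‖` to the derivative of `‖p - q‖²`. -/
theorem norm_yosidaExp_sub_sq_le (hR : IsResolvent Γ h R) (hQ : IsResolvent Γ k Q) {t : ℝ}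
    (ht : 0 ≤ t) {x y : X} (hA : FormRel Γ x y) :
    ‖yosidaExp R h t x - yosidaExp Q k t x‖ ^ 2 ≤ 4 * (h + k) * ‖y‖ ^ 2 * t := by
  let p := fun s => yosidaExp R h s x
  let q := fun s => yosidaExp Q k s x
  have hd : ∀ s, HasDerivAt (fun s => ‖p s - q s‖ ^ 2 - 4 * (h + k) * ‖y‖ ^ 2 * s)
      (2 * ⟪p s - q s, -yosida R h (p s) - -yosida Q k (q s)⟫_ℝ
        - 4 * (h + k) * ‖y‖ ^ 2 * 1) s := fun s =>
    ((hasDerivAt_yosidaExp R h s x).sub (hasDerivAt_yosidaExp Q k s x)).norm_sq.sub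
      ((hasDerivAt_id s).const_mul _)
  have hanti : AntitoneOn (fun s => ‖p s - q s‖ ^ 2 - 4 * (h + k) * ‖y‖ ^ 2 * s) (Ici 0) := by
    refine antitoneOn_of_deriv_nonpos (convex_Ici 0)
      (fun s _ => (hd s).continuousAt.continuousWithinAt)
      (fun s _ => (hd s).differentiableAt.differentiableWithinAt) fun s hs => ?_
    rw [interior_Ici] at hs
    rw [(hd s).deriv]
    set a := yosida R h (p s)
    set b := yosida Q k (q s)
    have ha : ‖a‖ ≤ ‖y‖ := norm_yosida_yosidaExp_le hR (le_of_lt hs) hA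
    have hb : ‖b‖ ≤ ‖y‖ := norm_yosida_yosidaExp_le hQ (le_of_lt hs) hA
    have hmono := ((hR.2 (p s)).sub (hQ.2 (q s))).inner_nonneg
    have e1 : p s - q s = (R (p s) - Q (q s)) + (h • a - k • b) := by
      rw [hR.apply_eq, hQ.apply_eq]; abel
    have e2 : ⟪p s - q s, -a - -b⟫_ℝ = -⟪a - b, R (p s) - Q (q s)⟫_ℝ - ⟪a - b, h • a - k • b⟫_ℝ := by
      rw [real_inner_comm, e1, show -a - -b = -(a - b) by abel, inner_neg_left, inner_add_right]
      ring
    have e3 : -⟪a - b, h • a - k • b⟫_ℝ ≤ 2 * ‖y‖ * ((h + k) * ‖y‖) := by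
      refine (neg_le_abs _).trans ((abs_real_inner_le_norm _ _).trans ?_)
      refine mul_le_mul ?_ ?_ (norm_nonneg _) (by positivity)
      · exact (norm_sub_le _ _).trans (by linarith)
      · refine (norm_sub_le _ _).trans ?_
        rw [norm_smul, norm_smul, Real.norm_of_nonneg hR.1.le, Real.norm_of_nonneg hQ.1.le]
        nlinarith [hR.1, hQ.1]
    rw [e2]
    nlinarith
  have := hanti (mem_Ici.2 le_rfl) (mem_Ici.2 ht) ht
  simp only [p, q, yosidaExp_zero, one_apply_eq_self, sub_self, norm_zero] at this
  linarith

/-- Hille--Yosida: for an initial value in the domain of `A²` there is a strong solution. -/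
theorem exists_solution [CompleteSpace G] (hΓ : IsClosed (Γ : Set (X × G))) {x y z : X}
    (hxy : FormRel Γ x y) (hyz : FormRel Γ y z) :
    ∃ V W : ℝ → X, V 0 = x ∧ ContinuousOn V (Ici 0) ∧
      ∀ t, 0 < t → HasDerivAt V (-W t) t ∧ FormRel Γ (V t) (W t) ∧ ‖W t‖ ≤ ‖y‖ := by
  let h : ℕ → ℝ := fun n => 1 / ((n : ℝ) + 1)
  have hpos : ∀ n, 0 < h n := fun n => Nat.one_div_pos_of_nat
  have hlim : Tendsto h atTop (𝓝 0) := tendsto_one_div_add_atTop_nhds_zero_nat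
  choose R hR' using fun n => exists_resolvent Γ hΓ (hpos n)
  have hR : ∀ n, IsResolvent Γ (h n) (R n) := fun n => ⟨hpos n, hR' n⟩
  have hanti : ∀ {m n}, m ≤ n → h n ≤ h m := fun hmn => Nat.one_div_le_one_div hmn
  have hcauchy : ∀ {x y : X}, FormRel Γ x y → ∀ T, UniformCauchySeqOn
      (fun n t => yosidaExp (R n) (h n) t x) atTop (Icc 0 T) := by
    intro x y hA T
    rw [Metric.uniformCauchySeqOn_iff]
    intro ε hε
    have hl : Tendsto (fun n => 4 * (h n + h n) * ‖y‖ ^ 2 * T) atTop (𝓝 0) := by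
      have := (((hlim.add hlim).const_mul 4).mul_const (‖y‖ ^ 2)).mul_const T
      simpa using this
    obtain ⟨M, hM⟩ := eventually_atTop.1 (hl.eventually_lt_const (pow_pos hε 2))
    refine ⟨M, fun m hm n hn t ht => ?_⟩
    rw [dist_eq_norm]
    refine lt_of_pow_lt_pow_left₀ 2 hε.le (lt_of_le_of_lt ?_ (hM M le_rfl))
    refine (norm_yosidaExp_sub_sq_le (hR m) (hR n) ht.1 hA).trans ?_
    have h1 := hanti hm
    have h2 := hanti hn
    have := hpos m
    have := hpos n
    have := hpos M
    refine mul_le_mul (mul_le_mul_of_nonneg_right (by linarith) (sq_nonneg _)) ht.2 ht.1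
      (by positivity)
  have hconv : ∀ {x y : X}, FormRel Γ x y → ∃ V : ℝ → X, ∀ T, TendstoUniformlyOn
      (fun n t => yosidaExp (R n) (h n) t x) V atTop (Icc 0 T) := by
    intro x y hA
    have hpt : ∀ t : ℝ, ∃ v, 0 ≤ t → Tendsto (fun n => yosidaExp (R n) (h n) t x) atTop (𝓝 v) := by
      intro t
      by_cases ht : 0 ≤ t
      · obtain ⟨v, hv⟩ := cauchySeq_tendsto_of_complete
          ((hcauchy hA t).cauchySeq (x := t) ⟨ht, le_rfl⟩)
        exact ⟨v, fun _ => hv⟩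
      · exact ⟨0, fun h => absurd h ht⟩
    choose V hV using hpt
    exact ⟨V, fun T => (hcauchy hA T).tendstoUniformlyOn_of_tendsto fun t ht => hV t ht.1⟩
  obtain ⟨V, hV⟩ := hconv hxy
  obtain ⟨W, hW⟩ := hconv hyz
  have hVpt : ∀ t, 0 ≤ t → Tendsto (fun n => yosidaExp (R n) (h n) t x) atTop (𝓝 (V t)) :=
    fun t ht => (hV t).tendsto_at ⟨ht, le_rfl⟩
  -- This is where `y` has to lie in the domain: `A_h` commutes with its exponential, and `A_h x →
  -- y` at rate `h ‖z‖`, so the time derivatives converge uniformly to those expected from the orbit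
  -- of `y`.
  have hdiff : ∀ T, TendstoUniformlyOn
      (fun n t => -yosida (R n) (h n) (yosidaExp (R n) (h n) t x)) (fun t => -W t) atTop
        (Icc 0 T) := by
    intro T
    rw [Metric.tendstoUniformlyOn_iff]
    intro ε hε
    have h1 := Metric.tendstoUniformlyOn_iff.1 (hW T) (ε / 2) (half_pos hε)
    have hl : Tendsto (fun n => h n * ‖z‖) atTop (𝓝 0) := by simpa using hlim.mul_const ‖z‖
    filter_upwards [h1, hl.eventually_lt_const (half_pos hε)] with n hn1 hn2 t ht
    have e1 := hn1 t ht
    rw [dist_neg_neg]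
    refine (dist_triangle _ _ _).trans_lt (lt_of_lt_of_eq (add_lt_add e1 ?_) (add_halves ε))
    rw [dist_comm, dist_eq_norm, ← yosidaExp_yosida, ← map_sub]
    exact ((norm_yosidaExp_le (hR n) ht.1 _).trans ((hR n).norm_yosida_sub_le hxy hyz)).trans_lt hn2
  refine ⟨V, W, ?_, ?_, fun t ht => ⟨?_, ?_, ?_⟩⟩
  · have := hVpt 0 le_rfl
    simp only [yosidaExp_zero, one_apply_eq_self] at this
    exact tendsto_nhds_unique this tendsto_const_nhds
  · intro t ht
    have hc : ContinuousOn V (Icc 0 (t + 1)) := (hV (t + 1)).continuousOn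
      (Eventually.of_forall fun n s _ =>
        (hasDerivAt_yosidaExp (R n) (h n) s x).continuousAt.continuousWithinAt).frequently
    refine (hc t ⟨ht, by linarith⟩).mono_of_mem_nhdsWithin ?_
    rw [← Ici_inter_Iic]
    exact inter_mem_nhdsWithin _ (Iic_mem_nhds (by linarith))
  · have hu := (hdiff (t + 1)).mono Ioo_subset_Icc_self
    refine hasDerivAt_of_tendstoUniformlyOn isOpen_Ioo hu
      (Eventually.of_forall fun n s _ => hasDerivAt_yosidaExp (R n) (h n) s x)
      (fun s hs => hVpt s hs.1.le) ⟨ht, by linarith⟩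
  · have h1 : Tendsto (fun n => yosida (R n) (h n) (yosidaExp (R n) (h n) t x)) atTop (𝓝 (W t)) := by
      have := ((hdiff t).tendsto_at (x := t) ⟨ht.le, le_rfl⟩).neg
      simpa using this
    -- The exact pairs are `(R v, A_h v)` with `v` the approximate solution; `v - R v = h A_h v`
    -- tends to zero, so closedness applies in the limit.
    refine FormRel.of_tendsto hΓ (fun n => (hR n).2 (yosidaExp (R n) (h n) t x)) ?_ h1
    simp_rw [fun n => (hR n).apply_eq (yosidaExp (R n) (h n) t x)]
    have h2 := hlim.smul h1
    simpa using (hVpt t ht.le).sub h2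
  · have h1 : Tendsto (fun n => yosidaExp (R n) (h n) t y) atTop (𝓝 (W t)) :=
      (hW t).tendsto_at ⟨ht.le, le_rfl⟩
    exact le_of_tendsto h1.norm (Eventually.of_forall fun n => norm_yosidaExp_le (hR n) ht.le y)

end Yosida

/-! ### The jump measure and the Dirichlet form. -/

variable {N : ℕ}

/-- The measure `½ J(x, y) dx dy`. -/
def jumpMeasure (J : Space N → Space N → ℝ) : Measure (Space N × Space N) :=
  ((volume : Measure (Space N)).prod volume).withDensity
    fun z => ENNReal.ofReal (1 / 2 * J z.1 z.2)

/-- The increment `f(x) - f(y)`. -/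
def jump (f : Space N → ℝ) (z : Space N × Space N) : ℝ := f z.1 - f z.2

section Jump

variable {J : Space N → Space N → ℝ} {f g : Space N → ℝ}

theorem quasiMeasurePreserving_fst_jumpMeasure (J : Space N → Space N → ℝ) :
    Measure.QuasiMeasurePreserving Prod.fst (jumpMeasure J) volume :=
  Measure.quasiMeasurePreserving_fst.mono_left (withDensity_absolutelyContinuous _ _)

theorem quasiMeasurePreserving_snd_jumpMeasure (J : Space N → Space N → ℝ) :
    Measure.QuasiMeasurePreserving Prod.snd (jumpMeasure J) volume :=
  Measure.quasiMeasurePreserving_snd.mono_left (withDensity_absolutelyContinuous _ _)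

/-- Both coordinate projections pull Lebesgue null sets back to null sets, so increments are well
defined on almost everywhere classes. -/
theorem ae_jumpMeasure {P : Space N → Prop} (h : ∀ᵐ x, P x) :
    ∀ᵐ z ∂jumpMeasure J, P z.1 ∧ P z.2 :=
  ((quasiMeasurePreserving_fst_jumpMeasure J).ae h).and
    ((quasiMeasurePreserving_snd_jumpMeasure J).ae h)

theorem jump_congr (h : f =ᵐ[volume] g) : jump f =ᵐ[jumpMeasure J] jump g := by
  filter_upwards [ae_jumpMeasure (J := J) h] with z hz
  rw [jump, jump, hz.1, hz.2]

theorem aestronglyMeasurable_jump (hf : AEStronglyMeasurable f volume) :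
    AEStronglyMeasurable (jump f) (jumpMeasure J) :=
  (hf.comp_quasiMeasurePreserving (quasiMeasurePreserving_fst_jumpMeasure J)).sub
    (hf.comp_quasiMeasurePreserving (quasiMeasurePreserving_snd_jumpMeasure J))

theorem jump_add : jump (f + g) = jump f + jump g := by
  ext z; simp only [jump, Pi.add_apply]; ring

theorem jump_smul (c : ℝ) : jump (c • f) = c • jump f := by
  ext z; simp only [jump, Pi.smul_apply, smul_eq_mul]; ring

theorem lintegral_jumpMeasure (hJ : IsLevyKernel J) (f g : Space N → ℝ) :
    ∫⁻ z, ENNReal.ofReal (1 / 2 * ((f z.1 - f z.2) * (g z.1 - g z.2) * J z.1 z.2))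
        ∂((volume : Measure (Space N)).prod volume)
      = ∫⁻ z, ENNReal.ofReal (jump f z * jump g z) ∂jumpMeasure J := by
  rw [jumpMeasure, lintegral_withDensity_eq_lintegral_mul_non_measurable]
  · refine lintegral_congr fun z => ?_
    simp only [Pi.mul_apply, jump]
    -- On the diagonal `J` may be negative, but there the increments vanish.
    by_cases hz : z.1 = z.2
    · simp [hz]
    · rw [← ENNReal.ofReal_mul (by have := hJ.nonneg _ _ hz; positivity)]
      congr 1; ring
  · exact (hJ.measurable.const_mul _).ennreal_ofReal
  · exact Eventually.of_forall fun z => ENNReal.ofReal_lt_top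

theorem dirichletForm_eq (hJ : IsLevyKernel J) (f g : Space N → ℝ) :
    dirichletForm J f g = extIntegral (jumpMeasure J) fun z => jump f z * jump g z := by
  -- The negative part for `(f, g)` is the positive part for `(-f, g)`.
  have h2 := lintegral_jumpMeasure hJ (-f) g
  rw [dirichletForm, extIntegral, extIntegral, lintegral_jumpMeasure hJ]
  have e1 : ∀ z : Space N × Space N, -(1 / 2 * ((f z.1 - f z.2) * (g z.1 - g z.2) * J z.1 z.2))
      = 1 / 2 * (((-f) z.1 - (-f) z.2) * (g z.1 - g z.2) * J z.1 z.2) := fun z => by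
    simp only [Pi.neg_apply]; ring
  have e2 : ∀ z, -(jump f z * jump g z) = jump (-f) z * jump g z := fun z => by
    simp only [jump, Pi.neg_apply]; ring
  simp_rw [e1, e2, h2]

theorem extIntegral_of_integrable {X : Type*} [MeasurableSpace X] {μ : Measure X} {h : X → ℝ}
    (hh : Integrable h μ) : extIntegral μ h = ((∫ x, h x ∂μ : ℝ) : EReal) := by
  have h1 : ∫⁻ x, ENNReal.ofReal (h x) ∂μ ≠ ∞ := hh.lintegral_lt_top.ne
  have h2 : ∫⁻ x, ENNReal.ofReal (-h x) ∂μ ≠ ∞ := hh.neg.lintegral_lt_top.ne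
  rw [extIntegral, integral_eq_lintegral_pos_part_sub_lintegral_neg_part hh, EReal.coe_sub,
    EReal.coe_ennreal_toReal h1, EReal.coe_ennreal_toReal h2]

theorem dirichletForm_eq_integral (hJ : IsLevyKernel J) (hf : MemLp (jump f) 2 (jumpMeasure J))
    (hg : MemLp (jump g) 2 (jumpMeasure J)) :
    dirichletForm J f g = ((∫ z, jump f z * jump g z ∂jumpMeasure J : ℝ) : EReal) := by
  rw [dirichletForm_eq hJ]
  exact extIntegral_of_integrable (hf.integrable_mul hg)

theorem dirichletForm_self_lt_top_iff (hJ : IsLevyKernel J) (hf : AEStronglyMeasurable f volume) :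
    dirichletForm J f f < ⊤ ↔ MemLp (jump f) 2 (jumpMeasure J) := by
  refine ⟨fun h => ?_, fun h => ?_⟩
  · have h0 : ∫⁻ z, ENNReal.ofReal (-(jump f z * jump f z)) ∂jumpMeasure J = 0 := by
      rw [lintegral_eq_zero_of_ae_eq_zero]
      exact Eventually.of_forall fun z =>
        ENNReal.ofReal_eq_zero.2 (neg_nonpos.2 (mul_self_nonneg _))
    rw [dirichletForm_eq hJ, extIntegral, h0, EReal.coe_ennreal_zero, sub_zero,
      ← EReal.coe_ennreal_top, EReal.coe_ennreal_lt_coe_ennreal_iff] at h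
    rw [memLp_two_iff_integrable_sq (aestronglyMeasurable_jump hf)]
    refine ⟨(aestronglyMeasurable_jump hf).pow 2, ?_⟩
    rw [hasFiniteIntegral_iff_ofReal (Eventually.of_forall fun z => sq_nonneg _)]
    simpa only [sq] using h
  · rw [dirichletForm_eq_integral hJ h h]
    exact EReal.coe_lt_top _

theorem memEnergySpace_iff (hJ : IsLevyKernel J) :
    MemEnergySpace J f ↔ MemLp f 2 volume ∧ MemLp (jump f) 2 (jumpMeasure J) :=
  and_congr_right fun h => dirichletForm_self_lt_top_iff hJ h.1

/-- Functions that are Lipschitz on the range of `f` operate on the energy space. -/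
theorem memLp_jump_comp {φ : ℝ → ℝ} {S : Set ℝ} {K : ℝ} (hφ : Measurable φ)
    (hL : ∀ a ∈ S, ∀ b ∈ S, |φ a - φ b| ≤ K * |a - b|) (hf : AEStronglyMeasurable f volume)
    (hS : ∀ᵐ x, f x ∈ S) (hj : MemLp (jump f) 2 (jumpMeasure J)) :
    MemLp (jump fun x => φ (f x)) 2 (jumpMeasure J) := by
  refine MemLp.of_le_mul (c := K) hj
    (aestronglyMeasurable_jump (hφ.comp_aemeasurable hf.aemeasurable).aestronglyMeasurable) ?_
  filter_upwards [ae_jumpMeasure (J := J) hS] with z hz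
  exact hL _ hz.1 _ hz.2

theorem memLp_comp {φ : ℝ → ℝ} {S : Set ℝ} {K : ℝ} (hφ : Measurable φ)
    (hL : ∀ a ∈ S, |φ a| ≤ K * |a|) (hS : ∀ᵐ x, f x ∈ S) (hf : MemLp f 2 volume) :
    MemLp (fun x => φ (f x)) 2 volume := by
  refine MemLp.of_le_mul (c := K) hf
    (hφ.comp_aemeasurable hf.1.aemeasurable).aestronglyMeasurable ?_
  filter_upwards [hS] with x hx
  exact hL _ hx

end Jump

/-! ### The increment map as a closed operator. -/

/-- The graph of the map `f ↦ f(x) - f(y)` from `L²(ℝ^N)` to `L²(½ J(x, y) dx dy)`. -/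
def jumpGraph (J : Space N → Space N → ℝ) : Submodule ℝ (L2 N × Lp ℝ 2 (jumpMeasure J)) where
  carrier := {z | ⇑z.2 =ᵐ[jumpMeasure J] jump z.1}
  add_mem' := by
    intro a b ha hb
    have h1 := jump_congr (J := J) (Lp.coeFn_add a.1 b.1)
    rw [jump_add] at h1
    have ha' : ⇑a.2 =ᵐ[jumpMeasure J] jump a.1 := ha
    have hb' : ⇑b.2 =ᵐ[jumpMeasure J] jump b.1 := hb
    exact (Lp.coeFn_add _ _).trans ((ha'.add hb').trans h1.symm)
  zero_mem' := by
    have h1 := jump_congr (J := J) (Lp.coeFn_zero ℝ 2 (volume : Measure (Space N)))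
    refine (Lp.coeFn_zero _ _ _).trans (EventuallyEq.trans ?_ h1.symm)
    exact Eventually.of_forall fun z => by simp [jump]
  smul_mem' := by
    intro c a ha
    have h1 := jump_congr (J := J) (Lp.coeFn_smul c a.1)
    rw [jump_smul] at h1
    have ha' : ⇑a.2 =ᵐ[jumpMeasure J] jump a.1 := ha
    exact (Lp.coeFn_smul _ _).trans ((ha'.const_smul c).trans h1.symm)

section Graph

variable {J : Space N → Space N → ℝ}

theorem mem_jumpGraph {z : L2 N × Lp ℝ 2 (jumpMeasure J)} :
    z ∈ jumpGraph J ↔ ⇑z.2 =ᵐ[jumpMeasure J] jump z.1 := Iff.rfl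

theorem exists_seq_tendsto_ae_Lp {X : Type*} [MeasurableSpace X] {μ : Measure X}
    {a : ℕ → Lp ℝ 2 μ} {b : Lp ℝ 2 μ} (h : Tendsto a atTop (𝓝 b)) :
    ∃ ns : ℕ → ℕ, StrictMono ns ∧ ∀ᵐ x ∂μ, Tendsto (fun i => a (ns i) x) atTop (𝓝 (b x)) :=
  (tendstoInMeasure_of_tendsto_Lp h).exists_seq_tendsto_ae

/-- Along a common subsequence functions and increments converge almost everywhere, and taking
increments respects pointwise limits. -/
theorem isClosed_jumpGraph (J : Space N → Space N → ℝ) :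
    IsClosed (jumpGraph J : Set (L2 N × Lp ℝ 2 (jumpMeasure J))) := by
  refine IsSeqClosed.isClosed fun a b ha hab => ?_
  obtain ⟨h1, h2⟩ := (Prod.tendsto_iff _ _).1 hab
  obtain ⟨ns, hns, h3⟩ := exists_seq_tendsto_ae_Lp h1
  obtain ⟨ms, hms, h4⟩ := exists_seq_tendsto_ae_Lp (h2.comp hns.tendsto_atTop)
  have h5 : ∀ᵐ z ∂jumpMeasure J, ∀ n, (a n).2 z = jump (a n).1 z := ae_all_iff.2 fun n => ha n
  filter_upwards [h4, h5, ae_jumpMeasure (J := J) h3] with z e1 e2 e3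
  refine tendsto_nhds_unique e1 ?_
  have := (e3.1.sub e3.2).comp hms.tendsto_atTop
  refine this.congr fun i => ?_
  simp only [Function.comp_apply]
  rw [e2]
  rfl

theorem memLp_jump_of_mem {z : L2 N × Lp ℝ 2 (jumpMeasure J)} (hz : z ∈ jumpGraph J) :
    MemLp (jump z.1) 2 (jumpMeasure J) := (memLp_congr_ae hz).1 (Lp.memLp z.2)

theorem toLp_mem_jumpGraph {f : Space N → ℝ} (hf : MemLp f 2 volume)
    (hj : MemLp (jump f) 2 (jumpMeasure J)) : (hf.toLp f, hj.toLp (jump f)) ∈ jumpGraph J :=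
  hj.coeFn_toLp.trans (jump_congr hf.coeFn_toLp.symm)

theorem inner_eq_integral {X : Type*} [MeasurableSpace X] {μ : Measure X} (a b : Lp ℝ 2 μ) :
    ⟪a, b⟫_ℝ = ∫ x, a x * b x ∂μ := by
  rw [L2.inner_def]
  exact integral_congr_ae (Eventually.of_forall fun x => mul_comm _ _)

theorem norm_sq_eq_integral {X : Type*} [MeasurableSpace X] {μ : Measure X} (a : Lp ℝ 2 μ) :
    ‖a‖ ^ 2 = ∫ x, a x ^ 2 ∂μ := by
  rw [← real_inner_self_eq_norm_sq, inner_eq_integral]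
  simp only [sq]

theorem FormRel.memLp_jump {x y : L2 N} (h : FormRel (jumpGraph J) x y) :
    MemLp (jump x) 2 (jumpMeasure J) := by
  obtain ⟨ρ, hρ, -⟩ := h
  exact memLp_jump_of_mem (z := (x, ρ)) hρ

theorem FormRel.integral_eq {x y : L2 N} (h : FormRel (jumpGraph J) x y) {g : Space N → ℝ}
    (hg : MemLp g 2 volume) (hj : MemLp (jump g) 2 (jumpMeasure J)) :
    ∫ v, y v * g v = ∫ z, jump x z * jump g z ∂jumpMeasure J := by
  obtain ⟨ρ, hρ, h1⟩ := h
  have h2 := h1 _ (toLp_mem_jumpGraph hg hj)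
  rw [inner_eq_integral, inner_eq_integral] at h2
  have e1 : ∫ v, y v * hg.toLp g v = ∫ v, y v * g v := integral_congr_ae <| by
    filter_upwards [hg.coeFn_toLp] with v hv
    rw [hv]
  have e2 : ∫ z, ρ z * hj.toLp (jump g) z ∂jumpMeasure J
      = ∫ z, jump x z * jump g z ∂jumpMeasure J := integral_congr_ae <| by
    filter_upwards [hj.coeFn_toLp, mem_jumpGraph.1 hρ] with z hz hz'
    rw [hz, hz']
  rw [← e1, ← e2]
  exact h2

/-- The operator is accretive against nondecreasing Lipschitz functions of `x`. -/
theorem FormRel.integral_mul_comp_nonneg {x y : L2 N} (h : FormRel (jumpGraph J) x y) {φ : ℝ → ℝ}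
    {S : Set ℝ} {K : ℝ} (hφ : Measurable φ)
    (hL : ∀ a ∈ S, ∀ b ∈ S, |φ a - φ b| ≤ K * |a - b|) (h0 : ∀ a ∈ S, |φ a| ≤ K * |a|)
    (hmono : MonotoneOn φ S) (hS : ∀ᵐ v, x v ∈ S) : 0 ≤ ∫ v, y v * φ (x v) := by
  rw [h.integral_eq (memLp_comp hφ h0 hS (Lp.memLp x))
    (memLp_jump_comp hφ hL (Lp.memLp x).1 hS h.memLp_jump)]
  refine integral_nonneg_of_ae ?_
  filter_upwards [ae_jumpMeasure (J := J) hS] with z hz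
  simp only [jump, Pi.zero_apply]
  rcases le_total (x z.1) (x z.2) with hle | hle
  · exact mul_nonneg_of_nonpos_of_nonpos (sub_nonpos.2 hle)
      (sub_nonpos.2 (hmono hz.1 hz.2 hle))
  · exact mul_nonneg (sub_nonneg.2 hle) (sub_nonneg.2 (hmono hz.2 hz.1 hle))

end Graph

/-! ### Truncation and the Markov property of the resolvent. -/

/-- The part of a real number beyond `[-M, M]`. -/
def excess (M a : ℝ) : ℝ := max (a - M) 0 + min (a + M) 0

section Excess

variable {M : ℝ}

theorem measurable_excess (M : ℝ) : Measurable (excess M) := by unfold excess; fun_prop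

theorem monotone_excess (M : ℝ) : Monotone (excess M) := fun a b hab => by
  unfold excess
  gcongr

theorem abs_excess_sub_le (hM : 0 ≤ M) (a b : ℝ) : |excess M a - excess M b| ≤ |a - b| := by
  unfold excess
  rcases max_cases (a - M) 0 with h1 | h1 <;> rcases min_cases (a + M) 0 with h2 | h2 <;>
  rcases max_cases (b - M) 0 with h3 | h3 <;> rcases min_cases (b + M) 0 with h4 | h4 <;>
  rw [h1.1, h2.1, h3.1, h4.1] <;> rw [abs_le] <;>
  rcases abs_cases (a - b) with h5 | h5 <;> rw [h5.1] <;> constructor <;> linarith [h1.2, h2.2, h3.2, h4.2]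

theorem excess_zero (hM : 0 ≤ M) : excess M 0 = 0 := by
  simp [excess, hM]

theorem abs_excess_le (hM : 0 ≤ M) (a : ℝ) : |excess M a| ≤ |a| := by
  have := abs_excess_sub_le hM a 0
  rwa [excess_zero hM, sub_zero, sub_zero] at this

theorem excess_eq_zero_iff (hM : 0 ≤ M) {a : ℝ} : excess M a = 0 ↔ |a| ≤ M := by
  unfold excess
  rw [abs_le]
  rcases max_cases (a - M) 0 with h1 | h1 <;> rcases min_cases (a + M) 0 with h2 | h2 <;>
  rw [h1.1, h2.1] <;> constructor <;> intro h <;> (try constructor) <;> linarith [h1.2, h2.2]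

/-- Where the excess is nonzero, `a - b` has its sign and is at least as large, because `b` stays
within `[-M, M]`. -/
theorem sq_excess_le (hM : 0 ≤ M) {a b : ℝ} (hb : |b| ≤ M) :
    excess M a ^ 2 ≤ (a - b) * excess M a := by
  rw [abs_le] at hb
  unfold excess
  rcases max_cases (a - M) 0 with h1 | h1 <;> rcases min_cases (a + M) 0 with h2 | h2 <;>
  rw [h1.1, h2.1] <;> nlinarith [h1.2, h2.2, hb.1, hb.2]

/-- The resolvent is Markovian. -/
theorem IsResolvent.abs_apply_le {J : Space N → Space N → ℝ} {h : ℝ} {R : L2 N →L[ℝ] L2 N}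
    (hR : IsResolvent (jumpGraph J) h R) (hM : 0 ≤ M) {w : L2 N} (hw : ∀ᵐ v, |w v| ≤ M) :
    ∀ᵐ v, |R w v| ≤ M := by
  have h1 : 0 ≤ ∫ v, (yosida R h w) v * excess M (R w v) :=
    (hR.2 w).integral_mul_comp_nonneg (S := univ) (K := 1) (measurable_excess M)
      (fun a _ b _ => by rw [one_mul]; exact abs_excess_sub_le hM a b)
      (fun a _ => by rw [one_mul]; exact abs_excess_le hM a) ((monotone_excess M).monotoneOn _)
      (Eventually.of_forall fun _ => mem_univ _)
  have hme : MemLp (fun v => excess M (R w v)) 2 volume :=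
    memLp_comp (S := univ) (K := 1) (measurable_excess M)
      (fun a _ => by rw [one_mul]; exact abs_excess_le hM a)
      (Eventually.of_forall fun _ => mem_univ _) (Lp.memLp _)
  -- The resolvent equation is tested with the excess of `R w`: since `w - R w = h A_h w`, the left
  -- side is at most `-h` times a nonnegative integral, so the excess vanishes.
  have h2 : ∫ v, excess M (R w v) ^ 2 ≤ ∫ v, -(h * ((yosida R h w) v * excess M (R w v))) := by
    refine integral_mono_ae hme.integrable_sq
      (((Lp.memLp (yosida R h w)).integrable_mul hme).const_mul h).neg ?_
    have e1 : ⇑(yosida R h w) =ᵐ[volume] fun v => h⁻¹ * (w v - R w v) := by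
      filter_upwards [Lp.coeFn_smul h⁻¹ (w - R w), Lp.coeFn_sub w (R w)] with v e1 e2
      rw [yosida_apply, e1, Pi.smul_apply, e2, Pi.sub_apply, smul_eq_mul]
    filter_upwards [e1, hw] with v e1 e2
    rw [e1]
    refine (sq_excess_le hM e2).trans (le_of_eq ?_)
    have := hR.1.ne'
    field_simp
    ring
  rw [integral_neg, integral_const_mul] at h2
  have h3 : ∫ v, excess M (R w v) ^ 2 = 0 :=
    le_antisymm (h2.trans (by have := mul_nonneg hR.1.le h1; linarith))
      (integral_nonneg fun v => sq_nonneg _)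
  rw [integral_eq_zero_iff_of_nonneg (fun v => sq_nonneg _) hme.integrable_sq] at h3
  filter_upwards [h3] with v hv
  exact (excess_eq_zero_iff hM).1 (by simpa using hv)

end Excess

/-! ### Differentiation of integral functionals along curves in `L²`. -/

section Differentiation

theorem integrable_comp {φ : ℝ → ℝ} {S : Set ℝ} {K : ℝ} (hφ : Measurable φ)
    (hL : ∀ a ∈ S, |φ a| ≤ K * a ^ 2) (f : L2 N) (hS : ∀ᵐ x, f x ∈ S) :
    Integrable (fun x => φ (f x)) volume := by
  refine Integrable.mono' ((Lp.memLp f).integrable_sq.const_mul K)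
    (hφ.comp_aemeasurable (Lp.memLp f).1.aemeasurable).aestronglyMeasurable ?_
  filter_upwards [hS] with x hx using hL _ hx

/-- Second order Taylor bound for the functionals `∫ Φ(f)`. -/
theorem abs_integral_comp_sub_le {Φ Φ' ψ χ : ℝ → ℝ} {S : Set ℝ} {K δ : ℝ} (hΦ : Measurable Φ)
    (hΦ' : Measurable Φ') (hψ : Measurable ψ) (hχ : Measurable χ)
    (bΦ : ∀ a ∈ S, |Φ a| ≤ K * a ^ 2) (bΦ' : ∀ a ∈ S, |Φ' a| ≤ K * a ^ 2)
    (bψ : ∀ a ∈ S, |ψ a| ≤ K * |a|) (bχ : ∀ a ∈ S, |χ a| ≤ K * a ^ 2)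
    (hT : ∀ a ∈ S, ∀ b ∈ S, |Φ' b - Φ a - ψ a * (b - a) - δ * χ a|
      ≤ K * ((b - a) ^ 2 + δ ^ 2 * a ^ 2))
    (f g : L2 N) (hf : ∀ᵐ x, f x ∈ S) (hg : ∀ᵐ x, g x ∈ S) :
    |(∫ x, Φ' (g x)) - (∫ x, Φ (f x)) - (∫ x, ψ (f x) * (g - f) x) - δ * ∫ x, χ (f x)|
      ≤ K * (‖g - f‖ ^ 2 + δ ^ 2 * ‖f‖ ^ 2) := by
  have i1 := integrable_comp hΦ' bΦ' g hg
  have i2 := integrable_comp hΦ bΦ f hf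
  have i3 : Integrable (fun x => ψ (f x) * (g - f) x) volume :=
    (memLp_comp hψ bψ hf (Lp.memLp f)).integrable_mul (Lp.memLp (g - f))
  have i4 := (integrable_comp hχ bχ f hf).const_mul δ
  have i12 : Integrable (fun x => Φ' (g x) - Φ (f x)) volume := i1.sub i2
  have i123 : Integrable (fun x => Φ' (g x) - Φ (f x) - ψ (f x) * (g - f) x) volume := i12.sub i3
  rw [norm_sq_eq_integral, norm_sq_eq_integral, ← integral_const_mul, ← integral_const_mul,
    ← integral_sub i1 i2, ← integral_sub i12 i3, ← integral_sub i123 i4,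
    ← integral_add (Lp.memLp (g - f)).integrable_sq ((Lp.memLp f).integrable_sq.const_mul _),
    ← integral_const_mul]
  refine abs_integral_le_integral_abs.trans (integral_mono_ae
    (i123.sub i4).abs
    (((Lp.memLp (g - f)).integrable_sq.add
      ((Lp.memLp f).integrable_sq.const_mul _)).const_mul _) ?_)
  filter_upwards [hf, hg, Lp.coeFn_sub g f] with x e1 e2 e3
  have := hT _ e1 _ e2
  simp only [e3, Pi.sub_apply]
  exact this

theorem abs_integral_comp_mul_le {ψ : ℝ → ℝ} {S : Set ℝ} {K : ℝ} (hψ : Measurable ψ)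
    (bψ : ∀ a ∈ S, |ψ a| ≤ K * |a|) (f g : L2 N) (hf : ∀ᵐ x, f x ∈ S) :
    |∫ x, ψ (f x) * g x| ≤ K * ‖f‖ * ‖g‖ := by
  have hm := memLp_comp hψ bψ hf (Lp.memLp f)
  have e1 : ∫ x, ψ (f x) * g x = ⟪hm.toLp _, g⟫_ℝ := by
    rw [inner_eq_integral]
    refine integral_congr_ae ?_
    filter_upwards [hm.coeFn_toLp] with x hx
    rw [hx]
  rw [e1]
  refine (abs_real_inner_le_norm _ _).trans (mul_le_mul_of_nonneg_right ?_ (norm_nonneg _))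
  refine Lp.norm_le_mul_norm_of_ae_le_mul ?_
  filter_upwards [hm.coeFn_toLp, hf] with x hx hx'
  rw [hx]
  exact bψ _ hx'

/-- The pointwise quadratic remainder integrates to `‖w s - w r‖²` and `(s - r)² ‖w r‖²`, both `o(s
- r)`. Differentiability of the curve in `L²` is thus enough; nothing is needed at individual points
`x`. -/
theorem hasDerivAt_integral_comp {Ψ : ℝ → ℝ → ℝ} {ψ χ : ℝ → ℝ} {S : Set ℝ} {K r : ℝ}
    (hΨ : ∀ s, Measurable (Ψ s)) (hψ : Measurable ψ) (hχ : Measurable χ)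
    (bΨ : ∀ᶠ s in 𝓝 r, ∀ a ∈ S, |Ψ s a| ≤ K * a ^ 2)
    (bψ : ∀ a ∈ S, |ψ a| ≤ K * |a|) (bχ : ∀ a ∈ S, |χ a| ≤ K * a ^ 2)
    (hT : ∀ᶠ s in 𝓝 r, ∀ a ∈ S, ∀ b ∈ S, |Ψ s b - Ψ r a - ψ a * (b - a) - (s - r) * χ a|
      ≤ K * ((b - a) ^ 2 + (s - r) ^ 2 * a ^ 2))
    {w : ℝ → L2 N} {w' : L2 N} (hw : HasDerivAt w w' r) (hS : ∀ᶠ s in 𝓝 r, ∀ᵐ x, w s x ∈ S) :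
    HasDerivAt (fun s => ∫ x, Ψ s (w s x))
      ((∫ x, ψ (w r x) * w' x) + ∫ x, χ (w r x)) r := by
  have hSr := hS.self_of_nhds
  have ho := hasDerivAt_iff_isLittleO.1 hw
  have hO : (fun s => w s - w r) =O[𝓝 r] fun s => s - r := hw.isBigO_sub
  have hsq : (fun s : ℝ => (s - r) ^ 2) =o[𝓝 r] fun s => s - r := by
    have h1 : (fun s : ℝ => s - r) =o[𝓝 r] fun _ => (1 : ℝ) := by
      rw [Asymptotics.isLittleO_one_iff]
      simpa using (continuous_sub_right r).tendsto r
    have := h1.mul_isBigO (Asymptotics.isBigO_refl (fun s : ℝ => s - r) (𝓝 r))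
    simpa [sq] using this
  rw [hasDerivAt_iff_isLittleO]
  have hb : (fun s => K * (‖w s - w r‖ ^ 2 + (s - r) ^ 2 * ‖w r‖ ^ 2)
      + K * ‖w r‖ * ‖w s - w r - (s - r) • w'‖) =o[𝓝 r] fun s => s - r := by
    refine Asymptotics.IsLittleO.add ?_ (ho.norm_left.const_mul_left _)
    refine Asymptotics.IsLittleO.const_mul_left (Asymptotics.IsLittleO.add ?_ ?_) K
    · exact ((hO.norm_left.pow 2).trans_isLittleO hsq)
    · simpa only [mul_comm] using hsq.const_mul_left (‖w r‖ ^ 2)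
  refine Asymptotics.IsBigO.trans_isLittleO (Asymptotics.IsBigO.of_bound 1 ?_) hb
  filter_upwards [bΨ, hT, hS] with s h1 h2 h3
  rw [one_mul]
  refine le_trans ?_ (le_abs_self _)
  have e1 := abs_integral_comp_sub_le (hΨ r) (hΨ s) hψ hχ bΨ.self_of_nhds h1 bψ bχ h2 (w r) (w s)
    hSr h3
  have e2 := abs_integral_comp_mul_le hψ bψ (w r) (w s - w r - (s - r) • w') hSr
  have hm := memLp_comp hψ bψ hSr (Lp.memLp (w r))
  have i1 : Integrable (fun x => ψ (w r x) * (w s - w r) x) volume :=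
    hm.integrable_mul (Lp.memLp (w s - w r))
  have i2 : Integrable (fun x => (s - r) * (ψ (w r x) * w' x)) volume :=
    (hm.integrable_mul (Lp.memLp w')).const_mul _
  have e3 : ∫ x, ψ (w r x) * (w s - w r - (s - r) • w') x
      = (∫ x, ψ (w r x) * (w s - w r) x) - (s - r) * ∫ x, ψ (w r x) * w' x := by
    rw [← integral_const_mul, ← integral_sub i1 i2]
    refine integral_congr_ae ?_
    filter_upwards [Lp.coeFn_sub (w s - w r) ((s - r) • w'), Lp.coeFn_smul (s - r) w'] with x h4 h5
    simp only [h4, Pi.sub_apply, h5, Pi.smul_apply, smul_eq_mul]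
    ring
  rw [e3] at e2
  rw [Real.norm_eq_abs]
  refine le_trans (le_of_eq ?_) ((abs_add_le _ _).trans (add_le_add e1 e2))
  congr 1
  rw [smul_eq_mul]
  ring

end Differentiation

/-! ### Sup-norm bounds are preserved by the flow. -/

section Bounded

theorem lipschitzWith_excess {M : ℝ} (hM : 0 ≤ M) : LipschitzWith 1 (excess M) :=
  LipschitzWith.of_dist_le_mul fun a b => by
    rw [NNReal.coe_one, one_mul]; exact abs_excess_sub_le hM a b

theorem abs_sq_excess_taylor_le {M : ℝ} (hM : 0 ≤ M) (a b : ℝ) :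
    |excess M b ^ 2 - excess M a ^ 2 - 2 * excess M a * (b - a)| ≤ 2 * (b - a) ^ 2 := by
  unfold excess
  rcases max_cases (a - M) 0 with h1 | h1 <;> rcases min_cases (a + M) 0 with h2 | h2 <;>
  rcases max_cases (b - M) 0 with h3 | h3 <;> rcases min_cases (b + M) 0 with h4 | h4 <;>
  rw [h1.1, h2.1, h3.1, h4.1] <;> rw [abs_le] <;> constructor <;>
  nlinarith [h1.2, h2.2, h3.2, h4.2, sq_nonneg (b - a), sq_nonneg (b + a)]

/-- The integral of the squared excess starts at zero. It is nonincreasing, because the operator is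
accretive against the monotone function `2 * excess M`. -/
theorem ae_abs_le_of_formRel {J : Space N → Space N → ℝ} {M : ℝ} (hM : 0 ≤ M) {v w : ℝ → L2 N}
    (hv : ContinuousOn v (Ici 0)) (hd : ∀ t, 0 < t → HasDerivAt v (-w t) t)
    (hA : ∀ t, 0 < t → FormRel (jumpGraph J) (v t) (w t)) (h0 : ∀ᵐ x, |v 0 x| ≤ M) {t : ℝ}
    (ht : 0 ≤ t) : ∀ᵐ x, |v t x| ≤ M := by
  have hu : ∀ f : L2 N, ∀ᵐ x, f x ∈ (univ : Set ℝ) := fun f => Eventually.of_forall fun _ => mem_univ _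
  have hlip := lipschitzWith_excess hM
  have hsq : ∀ f : L2 N, ∫ x, excess M (f x) ^ 2 = ‖hlip.compLp (excess_zero hM) f‖ ^ 2 := by
    intro f
    rw [norm_sq_eq_integral]
    refine integral_congr_ae ?_
    filter_upwards [hlip.coeFn_compLp (excess_zero hM) f] with x hx
    rw [hx, Function.comp_apply]
  have hb : ∀ a ∈ (univ : Set ℝ), |excess M a ^ 2| ≤ 2 * a ^ 2 := fun a _ => by
    rw [abs_of_nonneg (sq_nonneg _), ← sq_abs a, ← sq_abs (excess M a)]
    have := pow_le_pow_left₀ (abs_nonneg _) (abs_excess_le hM a) 2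
    nlinarith [sq_nonneg |a|]
  have hb' : ∀ a ∈ (univ : Set ℝ), |2 * excess M a| ≤ 2 * |a| := fun a _ => by
    rw [abs_mul, abs_two]
    linarith [abs_excess_le hM a]
  have hderiv : ∀ t, 0 < t → HasDerivAt (fun s => ∫ x, excess M (v s x) ^ 2)
      ((∫ x, 2 * excess M (v t x) * (-w t) x) + ∫ _x : Space N, (0 : ℝ)) t := by
    intro t ht
    refine hasDerivAt_integral_comp (Ψ := fun _ a => excess M a ^ 2) (ψ := fun a => 2 * excess M a)
      (χ := fun _ => 0) (S := univ) (K := 2)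
      (fun _ => (measurable_excess M).pow_const 2) ((measurable_excess M).const_mul 2)
      measurable_const (Eventually.of_forall fun _ => hb) hb'
      (fun a _ => by rw [abs_zero]; positivity) (Eventually.of_forall fun s a _ b _ => ?_)
      (hd t ht) (Eventually.of_forall fun s => hu _)
    have := abs_sq_excess_taylor_le hM a b
    have h2 : 0 ≤ (s - t) ^ 2 * a ^ 2 := by positivity
    rw [mul_zero, sub_zero]
    linarith
  have hanti : AntitoneOn (fun s => ∫ x, excess M (v s x) ^ 2) (Ici 0) := by
    refine antitoneOn_of_deriv_nonpos (convex_Ici 0) ?_ ?_ ?_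
    · simp_rw [hsq]
      exact (((hlip.continuous_compLp (excess_zero hM)).comp_continuousOn hv).norm).pow 2
    · rw [interior_Ici]
      exact fun s hs => (hderiv s hs).differentiableAt.differentiableWithinAt
    · rw [interior_Ici]
      intro s hs
      rw [(hderiv s hs).deriv, integral_zero, add_zero]
      have h1 := (hA s hs).integral_mul_comp_nonneg (φ := fun a => 2 * excess M a) (S := univ)
        (K := 2) ((measurable_excess M).const_mul 2)
        (fun a _ b _ => by
          rw [← mul_sub, abs_mul, abs_two]
          linarith [abs_excess_sub_le hM a b]) hb'
        (fun a _ b _ hab => by have := monotone_excess M hab; simp only; linarith) (hu _)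
      have h2 : ∫ x, 2 * excess M (v s x) * (-w s) x = -∫ x, w s x * (2 * excess M (v s x)) := by
        rw [← integral_neg]
        refine integral_congr_ae ?_
        filter_upwards [Lp.coeFn_neg (w s)] with x hx
        rw [hx, Pi.neg_apply]; ring
      rw [h2]
      linarith
  have h1 := hanti (mem_Ici.2 le_rfl) (mem_Ici.2 ht) ht
  have h2 : ∫ x, excess M (v 0 x) ^ 2 = 0 := by
    rw [integral_eq_zero_of_ae]
    filter_upwards [h0] with x hx
    rw [(excess_eq_zero_iff hM).2 hx]; simp
  simp only [h2] at h1
  have h3 := le_antisymm h1 (integral_nonneg fun x => sq_nonneg _)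
  have hi : Integrable (fun x => excess M (v t x) ^ 2) volume :=
    integrable_comp (φ := fun a => excess M a ^ 2) ((measurable_excess M).pow_const 2) hb _ (hu _)
  rw [integral_eq_zero_iff_of_nonneg (fun x => sq_nonneg _) hi] at h3
  filter_upwards [h3] with x hx
  exact (excess_eq_zero_iff hM).1 (by simpa using hx)

end Bounded

/-! ### Power inequalities: Taylor bounds and comparison of energies. -/

/-- The odd power `|a|^(r-2) a`. -/
def oddPow (r a : ℝ) : ℝ := |a| ^ (r - 2) * a

section Powers

variable {r s a b x y K : ℝ}

theorem measurable_oddPow (r : ℝ) : Measurable (oddPow r) := by unfold oddPow; fun_prop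

theorem oddPow_neg (r a : ℝ) : oddPow r (-a) = -oddPow r a := by
  rw [oddPow, oddPow, abs_neg, mul_neg]

theorem oddPow_of_nonneg (hr : 2 ≤ r) (ha : 0 ≤ a) : oddPow r a = a ^ (r - 1) := by
  rw [oddPow, abs_of_nonneg ha]
  rcases ha.eq_or_lt with rfl | ha
  · rw [mul_zero, Real.zero_rpow (by linarith)]
  · rw [← Real.rpow_add_one ha.ne']
    congr 1; ring

theorem abs_rpow_le_one (ha : |a| ≤ 1) (hr : 0 ≤ r) : |a| ^ r ≤ 1 :=
  Real.rpow_le_one (abs_nonneg a) ha hr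

theorem abs_rpow_le_sq (ha : |a| ≤ 1) (hr : 2 ≤ r) : |a| ^ r ≤ a ^ 2 := by
  rw [← sq_abs, ← Real.rpow_natCast]
  exact Real.rpow_le_rpow_of_exponent_ge_of_imp (abs_nonneg a) ha (by simpa using hr)
    (fun _ h => by linarith)

theorem abs_oddPow_le (ha : |a| ≤ 1) (hr : 2 ≤ r) : |oddPow r a| ≤ |a| := by
  rw [oddPow, abs_mul, abs_of_nonneg (Real.rpow_nonneg (abs_nonneg a) _)]
  exact mul_le_of_le_one_left (abs_nonneg a) (abs_rpow_le_one ha (by linarith))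

theorem abs_rpow_sub_rpow_le (hr : 1 ≤ r) (hx : x ∈ Icc (0 : ℝ) 1) (hy : y ∈ Icc (0 : ℝ) 1) :
    |y ^ r - x ^ r| ≤ r * |y - x| := by
  refine Convex.norm_image_sub_le_of_norm_hasDerivWithin_le (s := Icc (0 : ℝ) 1)
    (f := fun z => z ^ r) (f' := fun z => r * z ^ (r - 1))
    (fun z _ => (Real.hasDerivAt_rpow_const (Or.inr hr)).hasDerivWithinAt) (fun z hz => ?_)
    (convex_Icc 0 1) hx hy
  rw [norm_mul, Real.norm_of_nonneg (by linarith : 0 ≤ r),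
    Real.norm_of_nonneg (Real.rpow_nonneg hz.1 _)]
  exact mul_le_of_le_one_right (by linarith) (Real.rpow_le_one hz.1 hz.2 (by linarith))

theorem abs_abs_rpow_sub_le (hr : 1 ≤ r) (ha : |a| ≤ 1) (hb : |b| ≤ 1) :
    |(|a| ^ r - |b| ^ r)| ≤ r * |a - b| :=
  (abs_rpow_sub_rpow_le hr ⟨abs_nonneg b, hb⟩ ⟨abs_nonneg a, ha⟩).trans
    (mul_le_mul_of_nonneg_left (abs_abs_sub_abs_le_abs_sub a b) (by linarith))

theorem abs_oddPow_sub_le (hr : 2 ≤ r) (ha : |a| ≤ 1) (hb : |b| ≤ 1) :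
    |oddPow r a - oddPow r b| ≤ (r - 1) * |a - b| := by
  have hnn : ∀ {a b : ℝ}, |a| ≤ 1 → |b| ≤ 1 → 0 ≤ a → 0 ≤ b →
      |oddPow r a - oddPow r b| ≤ (r - 1) * |a - b| := by
    intro a b ha hb h1 h2
    rw [oddPow_of_nonneg hr h1, oddPow_of_nonneg hr h2]
    exact abs_rpow_sub_rpow_le (by linarith) ⟨h2, (le_abs_self b).trans hb⟩
      ⟨h1, (le_abs_self a).trans ha⟩
  have hop : ∀ {a b : ℝ}, |a| ≤ 1 → |b| ≤ 1 → a * b ≤ 0 →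
      |oddPow r a - oddPow r b| ≤ (r - 1) * |a - b| := by
    intro a b ha hb h1
    have h2 : |a| + |b| = |a - b| := by
      rcases abs_cases a with e1 | e1 <;> rcases abs_cases b with e2 | e2 <;>
        rcases abs_cases (a - b) with e3 | e3 <;> rw [e1.1, e2.1, e3.1] <;> nlinarith
    calc |oddPow r a - oddPow r b| ≤ |oddPow r a| + |oddPow r b| := abs_sub _ _
      _ ≤ |a - b| := h2 ▸ add_le_add (abs_oddPow_le ha hr) (abs_oddPow_le hb hr)
      _ ≤ (r - 1) * |a - b| := le_mul_of_one_le_left (abs_nonneg _) (by linarith)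
  rcases le_total 0 a with h1 | h1 <;> rcases le_total 0 b with h2 | h2
  · exact hnn ha hb h1 h2
  · exact hop ha hb (mul_nonpos_of_nonneg_of_nonpos h1 h2)
  · exact hop ha hb (mul_nonpos_of_nonpos_of_nonneg h1 h2)
  · have := hnn (a := -a) (b := -b) (by rwa [abs_neg]) (by rwa [abs_neg]) (by linarith)
      (by linarith)
    rwa [oddPow_neg, oddPow_neg, ← neg_sub', abs_neg, ← neg_sub', abs_neg] at this

theorem abs_abs_rpow_taylor_le (hr : 2 ≤ r) (ha : |a| ≤ 1) (hb : |b| ≤ 1) :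
    |(|b| ^ r - |a| ^ r - r * oddPow r a * (b - a))| ≤ r * (r - 1) * (b - a) ^ 2 := by
  have h1 : ∀ x ∈ uIcc a b, HasDerivWithinAt (fun x => |x| ^ r - r * oddPow r a * x)
      (r * oddPow r x - r * oddPow r a) (uIcc a b) x := by
    intro x _
    have := (hasDerivAt_abs_rpow x (by linarith : 1 < r)).sub
      ((hasDerivAt_id x).const_mul (r * oddPow r a))
    rw [mul_one, mul_assoc] at this
    exact this.hasDerivWithinAt
  have h2 := Convex.norm_image_sub_le_of_norm_hasDerivWithin_le (C := r * ((r - 1) * |b - a|)) h1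
    (fun x hx => ?_) (convex_uIcc a b) left_mem_uIcc right_mem_uIcc
  · rw [Real.norm_eq_abs, Real.norm_eq_abs] at h2
    convert h2 using 1
    · congr 1; ring
    · rw [← sq_abs (b - a)]; ring
  · have hx1 : |x| ≤ 1 := by
      rw [abs_le] at ha hb ⊢
      exact Icc_subset_Icc (le_min ha.1 hb.1) (max_le ha.2 hb.2) hx
    rw [← mul_sub, norm_mul, Real.norm_of_nonneg (by linarith : 0 ≤ r), Real.norm_eq_abs]
    refine mul_le_mul_of_nonneg_left ((abs_oddPow_sub_le hr hx1 ha).trans ?_) (by linarith)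
    exact mul_le_mul_of_nonneg_left (abs_sub_left_of_mem_uIcc hx) (by linarith)

theorem rpow_mul_abs_log_le {ε : ℝ} (hε : 0 < ε) (hx : 0 < x) (hx1 : x ≤ 1) :
    x ^ ε * |Real.log x| ≤ 1 / ε := by
  have := (Real.abs_log_mul_self_rpow_lt x ε hx hx1 hε).le
  rwa [abs_mul, abs_of_nonneg (Real.rpow_nonneg hx.le _), mul_comm] at this

/-- Second order Taylor bound for `r ↦ |a|^r`. -/
theorem abs_rpow_exponent_taylor_le {ε : ℝ} (hε : 0 < ε) (ha : |a| ≤ 1) (hr : 2 + ε ≤ r)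
    (hs : 2 + ε ≤ s) :
    |(|a| ^ s - |a| ^ r - (s - r) * (|a| ^ r * Real.log |a|))| ≤ (2 / ε) ^ 2 * ((s - r) ^ 2 * a ^ 2) := by
  rcases (abs_nonneg a).eq_or_lt with h0 | h0
  · rw [← h0, Real.zero_rpow (by linarith), Real.zero_rpow (by linarith)]
    simp only [sub_self, zero_mul, mul_zero, abs_zero]
    positivity
  rw [← sq_abs a]
  set x := |a|
  have hd : ∀ t : ℝ, HasDerivAt (fun t : ℝ => x ^ t) (x ^ t * Real.log x) t := fun t =>
    Real.hasStrictDerivAt_const_rpow h0 t |>.hasDerivAt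
  -- The factor `x^ε` beyond the square is split into two halves, each absorbing one logarithm at
  -- cost `2/ε`.
  have hb : ∀ t ∈ Ici (2 + ε), ‖x ^ t * Real.log x * Real.log x‖ ≤ (2 / ε) ^ 2 * x ^ 2 := by
    intro t ht
    have e1 := rpow_mul_abs_log_le (half_pos hε) h0 ha
    have e2 : x ^ t ≤ x ^ (2 + ε) := Real.rpow_le_rpow_of_exponent_ge h0 ha ht
    have e3 : x ^ (2 + ε) = x ^ 2 * (x ^ (ε / 2)) ^ 2 := by
      rw [← Real.rpow_natCast (x ^ (ε / 2)), ← Real.rpow_mul h0.le, ← Real.rpow_natCast x,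
        ← Real.rpow_add h0]
      congr 1; push_cast; ring
    rw [norm_mul, norm_mul, Real.norm_of_nonneg (Real.rpow_nonneg h0.le _), Real.norm_eq_abs]
    calc x ^ t * |Real.log x| * |Real.log x| = x ^ t * |Real.log x| ^ 2 := by ring
      _ ≤ x ^ (2 + ε) * |Real.log x| ^ 2 := by gcongr
      _ = (x ^ (ε / 2) * |Real.log x|) ^ 2 * x ^ 2 := by rw [e3]; ring
      _ ≤ (1 / (ε / 2)) ^ 2 * x ^ 2 := by gcongr
      _ = (2 / ε) ^ 2 * x ^ 2 := by rw [one_div_div]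
  have h1 : ∀ t : ℝ, t ∈ Ici (2 + ε) → ‖x ^ t * Real.log x - x ^ r * Real.log x‖
      ≤ (2 / ε) ^ 2 * x ^ 2 * ‖t - r‖ := fun t ht =>
    Convex.norm_image_sub_le_of_norm_hasDerivWithin_le
      (fun u _ => ((hd u).mul_const (Real.log x)).hasDerivWithinAt) hb (convex_Ici _) hr ht
  have hsub : uIcc r s ⊆ Ici (2 + ε) := fun u hu => (le_min hr hs).trans hu.1
  have h2 := Convex.norm_image_sub_le_of_norm_hasDerivWithin_le (s := uIcc r s)
    (C := (2 / ε) ^ 2 * x ^ 2 * |s - r|) (f := fun t => x ^ t - x ^ r * Real.log x * t)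
    (f' := fun t => x ^ t * Real.log x - x ^ r * Real.log x)
    (fun u _ => by
      have := (hd u).sub ((hasDerivAt_id u).const_mul (x ^ r * Real.log x))
      rw [mul_one] at this
      exact this.hasDerivWithinAt)
    (fun t ht => (h1 t (hsub ht)).trans (mul_le_mul_of_nonneg_left
      (abs_sub_left_of_mem_uIcc ht) (by positivity))) (convex_uIcc r s) left_mem_uIcc right_mem_uIcc
  rw [Real.norm_eq_abs, Real.norm_eq_abs] at h2
  convert h2 using 1
  · congr 1; ring
  · rw [← sq_abs (s - r)]; ring

/-- Controls the cross term of the joint expansion: the first-order coefficient is Lipschitz in the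
exponent, with a factor `|a|` to spare. -/
theorem abs_mul_oddPow_sub_le {ε R : ℝ} (hε : 0 < ε) (ha : |a| ≤ 1) (hr : r ∈ Icc (2 + ε) R)
    (hs : s ∈ Icc (2 + ε) R) :
    |s * oddPow s a - r * oddPow r a| ≤ (1 + R / ε) * (|s - r| * |a|) := by
  rcases (abs_nonneg a).eq_or_lt with h0 | h0
  · rw [abs_eq_zero.1 h0.symm, oddPow, oddPow]
    simp
  have hd : ∀ t, HasDerivAt (fun t => t * |a| ^ (t - 2))
      (1 * |a| ^ (t - 2) + t * (|a| ^ (t - 2) * Real.log |a|)) t := fun t =>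
    (hasDerivAt_id t).mul (by
      have := (Real.hasStrictDerivAt_const_rpow h0 (t - 2)).hasDerivAt.comp t
        ((hasDerivAt_id t).sub_const 2)
      rw [mul_one] at this
      exact this)
  have h1 := Convex.norm_image_sub_le_of_norm_hasDerivWithin_le (s := Icc (2 + ε) R)
    (C := 1 + R / ε) (fun t _ => (hd t).hasDerivWithinAt) (fun t ht => ?_)
    (convex_Icc _ _) hr hs
  · have e1 : s * oddPow s a - r * oddPow r a
        = (s * |a| ^ (s - 2) - r * |a| ^ (r - 2)) * a := by
      simp only [oddPow]; ring
    rw [e1, abs_mul, ← mul_assoc]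
    exact mul_le_mul_of_nonneg_right h1 (abs_nonneg a)
  · have ht0 : 0 ≤ t := by linarith [ht.1]
    have e1 := rpow_mul_abs_log_le hε h0 ha
    have e2 : |a| ^ (t - 2) ≤ |a| ^ ε :=
      Real.rpow_le_rpow_of_exponent_ge h0 ha (by linarith [ht.1])
    have e3 : |a| ^ (t - 2) ≤ 1 := abs_rpow_le_one ha (by linarith [ht.1])
    have e4 : 0 ≤ |a| ^ (t - 2) := Real.rpow_nonneg h0.le _
    refine (norm_add_le _ _).trans (add_le_add ?_ ?_)
    · rwa [one_mul, Real.norm_of_nonneg e4]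
    · rw [norm_mul, norm_mul, Real.norm_of_nonneg ht0, Real.norm_of_nonneg e4, Real.norm_eq_abs,
        div_eq_mul_one_div]
      refine mul_le_mul ht.2 ((mul_le_mul_of_nonneg_right e2 (abs_nonneg _)).trans e1)
        (by positivity) (ht0.trans ht.2)

theorem abs_rpow_mul_log_le {ε : ℝ} (hε : 0 < ε) (ha : |a| ≤ 1) (hr : 2 + ε ≤ r) :
    |(|a| ^ r * Real.log |a|)| ≤ 1 / ε * a ^ 2 := by
  rcases (abs_nonneg a).eq_or_lt with h0 | h0
  · rw [← h0, Real.log_zero, mul_zero, abs_zero]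
    positivity
  rw [abs_mul, abs_of_nonneg (Real.rpow_nonneg h0.le _)]
  have e1 := rpow_mul_abs_log_le hε h0 ha
  have e2 : |a| ^ r ≤ |a| ^ ε * a ^ 2 := by
    rw [← sq_abs, ← Real.rpow_natCast |a| 2, ← Real.rpow_add h0]
    exact Real.rpow_le_rpow_of_exponent_ge h0 ha (by push_cast; linarith)
  calc |a| ^ r * |Real.log (|a|)| ≤ |a| ^ ε * a ^ 2 * |Real.log (|a|)| := by gcongr
    _ = |a| ^ ε * |Real.log (|a|)| * a ^ 2 := by ring
    _ ≤ 1 / ε * a ^ 2 := by gcongr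

/-- A constant for the Taylor bounds of `(r, a) ↦ |a|^r` on `[2 + ε, R] × [-1, 1]`. -/
def taylorConst (ε R : ℝ) : ℝ := R * R + (2 / ε) ^ 2 + (1 + R / ε) + 1 / ε + 1

theorem le_taylorConst {ε R : ℝ} (hε : 0 < ε) (hR : 2 ≤ R) :
    1 ≤ taylorConst ε R ∧ R ≤ taylorConst ε R ∧ 1 / ε ≤ taylorConst ε R := by
  have h1 : 0 ≤ R / ε := by positivity
  have h2 : 0 ≤ 1 / ε := by positivity
  have h3 : 0 ≤ (2 / ε) ^ 2 := by positivity
  unfold taylorConst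
  refine ⟨by nlinarith, by nlinarith, by nlinarith⟩

/-- Expand in the base at exponent `s`, then in the exponent at base `a`. Replacing `s * oddPow s a`
by `r * oddPow r a` costs a multiple of `|s - r| |a| |b - a|`, absorbed by the two squares. -/
theorem abs_rpow_joint_taylor_le {ε R : ℝ} (hε : 0 < ε) (hr : r ∈ Icc (2 + ε) R)
    (hs : s ∈ Icc (2 + ε) R) (ha : |a| ≤ 1) (hb : |b| ≤ 1) :
    |(|b| ^ s - |a| ^ r - r * oddPow r a * (b - a) - (s - r) * (|a| ^ r * Real.log |a|))|
      ≤ taylorConst ε R * ((b - a) ^ 2 + (s - r) ^ 2 * a ^ 2) := by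
  have h1 := abs_abs_rpow_taylor_le (by linarith [hs.1] : 2 ≤ s) ha hb
  have h2 := abs_mul_oddPow_sub_le hε ha hr hs
  have h3 := abs_rpow_exponent_taylor_le hε ha hr.1 hs.1
  have e1 : |b| ^ s - |a| ^ r - r * oddPow r a * (b - a) - (s - r) * (|a| ^ r * Real.log |a|)
      = (|b| ^ s - |a| ^ s - s * oddPow s a * (b - a)) + (s * oddPow s a - r * oddPow r a) * (b - a)
        + (|a| ^ s - |a| ^ r - (s - r) * (|a| ^ r * Real.log |a|)) := by ring
  have hR : 2 ≤ R := by linarith [hr.1, hr.2]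
  have h4 : s * (s - 1) * (b - a) ^ 2 ≤ R * R * (b - a) ^ 2 := by
    have : s * (s - 1) ≤ R * R := by nlinarith [hs.1, hs.2]
    exact mul_le_mul_of_nonneg_right this (sq_nonneg _)
  have h5 : |(s * oddPow s a - r * oddPow r a) * (b - a)|
      ≤ (1 + R / ε) * ((b - a) ^ 2 + (s - r) ^ 2 * a ^ 2) := by
    rw [abs_mul]
    have hc : 0 ≤ 1 + R / ε := by positivity
    calc _ ≤ (1 + R / ε) * (|s - r| * |a|) * |b - a| :=
          mul_le_mul_of_nonneg_right h2 (abs_nonneg _)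
      _ = (1 + R / ε) * (|s - r| * |a| * |b - a|) := by ring
      _ ≤ _ := by
        refine mul_le_mul_of_nonneg_left ?_ hc
        rw [← sq_abs (b - a), ← sq_abs (s - r), ← sq_abs a]
        nlinarith [sq_nonneg (|s - r| * |a| - |b - a|), sq_nonneg (|s - r| * |a|),
          sq_nonneg |b - a|]
  rw [e1]
  refine (abs_add_three _ _ _).trans ?_
  have p1 : 0 ≤ (s - r) ^ 2 * a ^ 2 := by positivity
  have p2 := sq_nonneg (b - a)
  have p3 : 0 ≤ (2 / ε) ^ 2 := by positivity
  have p4 : 0 ≤ 1 / ε := by positivity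
  unfold taylorConst
  nlinarith [mul_nonneg p3 p2, mul_nonneg p4 p2, mul_nonneg p4 p1, mul_nonneg (mul_self_nonneg R) p1]

theorem monotone_oddPow (hr : 2 ≤ r) : Monotone (oddPow r) := by
  have hnn : ∀ {a b : ℝ}, 0 ≤ a → a ≤ b → oddPow r a ≤ oddPow r b := fun h0 hab => by
    rw [oddPow_of_nonneg hr h0, oddPow_of_nonneg hr (h0.trans hab)]
    exact Real.rpow_le_rpow h0 hab (by linarith)
  have h0 : oddPow r 0 = 0 := by rw [oddPow, mul_zero]
  intro a b hab
  rcases le_total 0 a with h1 | h1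
  · exact hnn h1 hab
  · rcases le_total 0 b with h2 | h2
    · have e1 := hnn le_rfl h2
      have e2 := hnn le_rfl (neg_nonneg.2 h1)
      rw [h0, oddPow_neg] at e2
      linarith
    · have := hnn (neg_nonneg.2 h2) (neg_le_neg hab)
      rw [oddPow_neg, oddPow_neg] at this
      linarith

/-- The Stroock--Varopoulos inequality. -/
theorem sq_abs_rpow_half_sub_le (hr : 2 ≤ r) (a b : ℝ) :
    (|a| ^ (r / 2) - |b| ^ (r / 2)) ^ 2
      ≤ r ^ 2 / 4 * ((oddPow r a - oddPow r b) * (a - b)) := by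
  -- The mean value bound gives the constant `r²/4` instead of the sharp `r²/(4(r - 1))`; this is
  -- enough here.
  have hpos : ∀ {x y : ℝ}, 0 ≤ y → y ≤ x →
      (x ^ (r / 2) - y ^ (r / 2)) ^ 2 ≤ r ^ 2 / 4 * ((x ^ (r - 1) - y ^ (r - 1)) * (x - y)) := by
    intro x y hy hyx
    rcases hyx.eq_or_lt with rfl | hlt
    · simp
    have hx : 0 < x := hy.trans_lt hlt
    have h1 : x ^ (r / 2) - y ^ (r / 2) ≤ r / 2 * x ^ (r / 2 - 1) * (x - y) := by
      have h := Convex.norm_image_sub_le_of_norm_hasDerivWithin_le (s := Icc y x)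
        (f := fun z => z ^ (r / 2)) (f' := fun z => r / 2 * z ^ (r / 2 - 1))
        (C := r / 2 * x ^ (r / 2 - 1))
        (fun z _ => (Real.hasDerivAt_rpow_const (Or.inr (by linarith))).hasDerivWithinAt)
        (fun z hz => ?_) (convex_Icc y x) (left_mem_Icc.2 hyx) (right_mem_Icc.2 hyx)
      · rw [Real.norm_of_nonneg (by linarith : 0 ≤ x - y)] at h
        exact (le_abs_self _).trans h
      · have hz0 : 0 ≤ z := hy.trans hz.1
        rw [Real.norm_of_nonneg (by positivity)]
        have := Real.rpow_le_rpow hz0 hz.2 (by linarith : 0 ≤ r / 2 - 1)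
        gcongr
    have h2 : 0 ≤ x ^ (r / 2) - y ^ (r / 2) :=
      sub_nonneg.2 (Real.rpow_le_rpow hy hyx (by linarith))
    have h3 : x ^ (r - 2) * (x - y) ≤ x ^ (r - 1) - y ^ (r - 1) := by
      have e1 : x ^ (r - 1) = x ^ (r - 2) * x := by
        rw [← Real.rpow_add_one hx.ne']; congr 1; ring
      have e2 : y ^ (r - 1) ≤ x ^ (r - 2) * y := by
        have : y ^ (r - 1) = y ^ (r - 2) * y := by
          rw [← oddPow_of_nonneg hr hy, oddPow, abs_of_nonneg hy]
        rw [this]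
        exact mul_le_mul_of_nonneg_right (Real.rpow_le_rpow hy hyx (by linarith)) hy
      rw [e1]; linarith
    have e3 : (x ^ (r / 2 - 1)) ^ 2 = x ^ (r - 2) := by
      rw [← Real.rpow_natCast, ← Real.rpow_mul hx.le]; congr 1; push_cast; ring
    calc (x ^ (r / 2) - y ^ (r / 2)) ^ 2 ≤ (r / 2 * x ^ (r / 2 - 1) * (x - y)) ^ 2 :=
          pow_le_pow_left₀ h2 h1 2
      _ = r ^ 2 / 4 * ((x ^ (r / 2 - 1)) ^ 2 * (x - y) * (x - y)) := by ring
      _ = r ^ 2 / 4 * (x ^ (r - 2) * (x - y) * (x - y)) := by rw [e3]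
      _ ≤ _ := by
        have : 0 ≤ x - y := by linarith
        gcongr
  have habs : (|a| ^ (r - 1) - |b| ^ (r - 1)) * (|a| - |b|)
      ≤ (oddPow r a - oddPow r b) * (a - b) := by
    have e1 : ∀ c : ℝ, |c| ^ (r - 1) = |c| ^ (r - 2) * |c| := fun c => by
      rw [← oddPow_of_nonneg hr (abs_nonneg c), oddPow, abs_abs]
    rw [e1, e1, oddPow, oddPow]
    have e2 := abs_mul_abs_self a
    have e3 := abs_mul_abs_self b
    have e4 : a * b ≤ |a| * |b| := by rw [← abs_mul]; exact le_abs_self _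
    have e5 := Real.rpow_nonneg (abs_nonneg a) (r - 2)
    have e6 := Real.rpow_nonneg (abs_nonneg b) (r - 2)
    nlinarith [mul_le_mul_of_nonneg_left e4 (add_nonneg e5 e6)]
  refine le_trans ?_ (mul_le_mul_of_nonneg_left habs (by positivity))
  rcases le_total |b| |a| with h | h
  · exact hpos (abs_nonneg b) h
  · have := hpos (abs_nonneg a) h
    calc _ = (|b| ^ (r / 2) - |a| ^ (r / 2)) ^ 2 := by ring
      _ ≤ _ := this
      _ = _ := by ring

/-- For nonnegative numbers the energy of order `p` is at most that of the power `p / 2`. -/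
theorem oddPow_sub_mul_sub_le {p : ℝ} (hp : 2 ≤ p) (hx : 0 ≤ x) (hy : 0 ≤ y) :
    (oddPow p x - oddPow p y) * (x - y) ≤ (x ^ (p / 2) - y ^ (p / 2)) ^ 2 := by
  rw [oddPow_of_nonneg hp hx, oddPow_of_nonneg hp hy]
  have hmul : ∀ {z : ℝ}, 0 ≤ z → z ^ (p - 1) * z = (z ^ (p / 2)) ^ 2 := fun {z} hz => by
    rcases hz.eq_or_lt with rfl | hz'
    · rw [mul_zero, Real.zero_rpow (by linarith)]; ring
    · rw [← Real.rpow_add_one hz'.ne', ← Real.rpow_natCast, ← Real.rpow_mul hz]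
      congr 1; push_cast; ring
  have h1 := hmul hx
  have h2 := hmul hy
  -- After expansion the diagonal terms agree, and the cross terms compare by the
  -- arithmetic–geometric mean inequality.
  have h3 : 2 * (x ^ (p / 2) * y ^ (p / 2)) ≤ x ^ (p - 1) * y + y ^ (p - 1) * x := by
    have e : (x ^ (p / 2) * y ^ (p / 2)) ^ 2 = (x ^ (p - 1) * y) * (y ^ (p - 1) * x) := by
      rw [mul_pow, ← h1, ← h2]; ring
    have n1 : 0 ≤ x ^ (p - 1) * y := mul_nonneg (Real.rpow_nonneg hx _) hy
    have n2 : 0 ≤ y ^ (p - 1) * x := mul_nonneg (Real.rpow_nonneg hy _) hx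
    refine le_of_sq_le_sq ?_ (add_nonneg n1 n2)
    nlinarith [sq_nonneg (x ^ (p - 1) * y - y ^ (p - 1) * x)]
  nlinarith

end Powers

/-! ### Logarithmic Sobolev inequalities for bounded functions, down to order 2. -/

section LogSobolev

variable {J : Space N → Space N → ℝ} {r p C D : ℝ}

/-- The logarithmic Sobolev inequality of order `r` for functions with values in `[-1, 1]`,
as an inequality between real numbers. -/
def RealLogSobolev (J : Space N → Space N → ℝ) (r C D : ℝ) : Prop :=
  ∀ w : L2 N, (∀ᵐ v, |w v| ≤ 1) → MemLp (jump w) 2 (jumpMeasure J) →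
    r * (∫ v, |w v| ^ r * Real.log |w v|) - Phi (∫ v, |w v| ^ r)
      ≤ C * (∫ v, |w v| ^ r)
        + D * ∫ z, jump (fun v => oddPow r (w v)) z * jump w z ∂jumpMeasure J

theorem LogSobolev.integral_le (h : LogSobolev J r C D) {f : Space N → ℝ} (hf : Measurable f)
    (hE : MemEnergySpace J fun x => |f x| ^ (r / 2))
    (hi : Integrable (fun x => Phi (|f x| ^ r)) volume) {E : ℝ}
    (hD : dirichletForm J (fun x => |f x| ^ (r - 2) * f x) f ≤ (E : EReal)) :
    (∫ x, Phi (|f x| ^ r)) - Phi (∫ x, |f x| ^ r) ≤ C * (∫ x, |f x| ^ r) + D * E := by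
  have h1 := h.2 f hf hE
  have habs : ∀ x, |(|f x| ^ r)| = |f x| ^ r := fun x =>
    abs_of_nonneg (Real.rpow_nonneg (abs_nonneg _) _)
  simp only [entropy, habs] at h1
  rw [extIntegral_of_integrable hi] at h1
  have h2 : (D : EReal) * dirichletForm J (fun x => |f x| ^ (r - 2) * f x) f
      ≤ ((D * E : ℝ) : EReal) := by
    rw [EReal.coe_mul]
    exact mul_le_mul_of_nonneg_left hD (EReal.coe_nonneg.2 h.1.le)
  have h3 := h1.trans (add_le_add le_rfl h2)
  rw [← EReal.coe_sub, ← EReal.coe_add, EReal.coe_le_coe_iff] at h3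
  exact h3

theorem Phi_abs_rpow (hr : r ≠ 0) (a : ℝ) : Phi (|a| ^ r) = r * (|a| ^ r * Real.log |a|) := by
  rcases (abs_nonneg a).eq_or_lt with h0 | h0
  · rw [← h0, Real.zero_rpow hr, Phi]; simp
  · rw [Phi, Real.log_rpow h0]; ring

/-- Strictness of `2 < r` makes the entropy density integrable for an `L²` function bounded by 1;
the bound blows up as `r → 2`. -/
theorem abs_rpow_mul_log_le_of_two_lt (hr : 2 < r) {a : ℝ} (ha : a ∈ {a : ℝ | |a| ≤ 1}) :
    |(|a| ^ r * Real.log |a|)| ≤ 1 / (r - 2) * a ^ 2 :=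
  abs_rpow_mul_log_le (by linarith) ha (by linarith)

theorem measurable_abs_rpow (r : ℝ) : Measurable fun a : ℝ => |a| ^ r := by fun_prop

theorem measurable_abs_rpow_mul_log (r : ℝ) : Measurable fun a : ℝ => |a| ^ r * Real.log |a| := by
  fun_prop

variable {w : L2 N}

theorem integrable_abs_rpow_mul_log (hr : 2 < r) (hw : ∀ᵐ v, |w v| ≤ 1) :
    Integrable (fun v => |w v| ^ r * Real.log |w v|) volume :=
  integrable_comp (φ := fun a => |a| ^ r * Real.log |a|) (S := {a | |a| ≤ 1})
    (measurable_abs_rpow_mul_log r) (fun _ ha => abs_rpow_mul_log_le_of_two_lt hr ha) w hw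

theorem abs_abs_rpow_le_sq (hr : 2 ≤ r) {a : ℝ} (ha : |a| ≤ 1) : |(|a| ^ r)| ≤ 1 * a ^ 2 := by
  rw [abs_of_nonneg (Real.rpow_nonneg (abs_nonneg _) _), one_mul]
  exact abs_rpow_le_sq ha hr

theorem integrable_abs_rpow (hr : 2 ≤ r) (hw : ∀ᵐ v, |w v| ≤ 1) :
    Integrable (fun v => |w v| ^ r) volume :=
  integrable_comp (φ := fun a => |a| ^ r) (S := {a | |a| ≤ 1})
    (measurable_abs_rpow r) (fun _ ha => abs_abs_rpow_le_sq hr ha) w hw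

theorem memEnergySpace_abs_rpow_half (hJ : IsLevyKernel J) (hr : 2 ≤ r) (hw : ∀ᵐ v, |w v| ≤ 1)
    (hj : MemLp (jump w) 2 (jumpMeasure J)) : MemEnergySpace J fun x => |w x| ^ (r / 2) := by
  have hL : ∀ a ∈ {a : ℝ | |a| ≤ 1}, ∀ b ∈ {a : ℝ | |a| ≤ 1},
      |(|a| ^ (r / 2) - |b| ^ (r / 2))| ≤ r / 2 * |a - b| := fun a ha b hb =>
    abs_abs_rpow_sub_le (by linarith) ha hb
  refine (memEnergySpace_iff hJ).2 ⟨?_, ?_⟩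
  · refine memLp_comp (φ := fun a => |a| ^ (r / 2)) (S := {a | |a| ≤ 1}) (K := r / 2)
      (measurable_abs_rpow _) (fun a ha => ?_) hw (Lp.memLp w)
    have := hL a ha 0 (by simp)
    rwa [abs_zero, Real.zero_rpow (by linarith), sub_zero, sub_zero] at this
  · exact memLp_jump_comp (φ := fun a => |a| ^ (r / 2)) (measurable_abs_rpow _) hL
      (Lp.memLp w).1 hw hj

theorem memLp_oddPow (hr : 2 ≤ r) (hw : ∀ᵐ v, |w v| ≤ 1) :
    MemLp (fun v => oddPow r (w v)) 2 volume :=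
  memLp_comp (S := {a | |a| ≤ 1}) (K := 1) (measurable_oddPow r)
    (fun a ha => by rw [one_mul]; exact abs_oddPow_le ha hr) hw (Lp.memLp w)

theorem memLp_jump_oddPow (hr : 2 ≤ r) (hw : ∀ᵐ v, |w v| ≤ 1)
    (hj : MemLp (jump w) 2 (jumpMeasure J)) :
    MemLp (jump fun v => oddPow r (w v)) 2 (jumpMeasure J) :=
  memLp_jump_comp (S := {a | |a| ≤ 1}) (measurable_oddPow r)
    (fun _ ha _ hb => abs_oddPow_sub_le hr ha hb) (Lp.memLp w).1 hw hj

theorem jump_oddPow_mul_jump_nonneg (hr : 2 ≤ r) (f : Space N → ℝ) (z : Space N × Space N) :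
    0 ≤ jump (fun v => oddPow r (f v)) z * jump f z := by
  simp only [jump]
  rcases le_total (f z.1) (f z.2) with h | h
  · exact mul_nonneg_of_nonpos_of_nonpos (sub_nonpos.2 (monotone_oddPow hr h)) (sub_nonpos.2 h)
  · exact mul_nonneg (sub_nonneg.2 (monotone_oddPow hr h)) (sub_nonneg.2 h)

theorem LogSobolev.real (hJ : IsLevyKernel J) (hr : 2 < r) (h : LogSobolev J r C D) :
    RealLogSobolev J r C D := by
  intro w hw hj
  have hP : ∀ x, Phi (|w x| ^ r) = r * (|w x| ^ r * Real.log |w x|) := fun x =>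
    Phi_abs_rpow (by linarith) _
  have h1 := h.integral_le (Lp.stronglyMeasurable w).measurable
    (memEnergySpace_abs_rpow_half hJ hr.le hw hj)
    (by simp_rw [hP]; exact (integrable_abs_rpow_mul_log hr hw).const_mul r)
    (dirichletForm_eq_integral hJ (memLp_jump_oddPow hr.le hw hj) hj).le
  simp_rw [hP, integral_const_mul] at h1
  exact h1

/-- Meant for the energy density of `|w|^(r/p)`. As `r/p ≤ 1`, this function need not lie in `L²` or
have square-integrable increments, so only a pointwise majorant is available. -/
theorem extIntegral_le {X : Type*} [MeasurableSpace X] {μ : Measure X} {g h : X → ℝ}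
    (hgh : ∀ x, g x ≤ h x) (h0 : ∀ x, 0 ≤ h x) (hh : Integrable h μ) :
    extIntegral μ g ≤ ((∫ x, h x ∂μ : ℝ) : EReal) := by
  have h1 : (∫⁻ x, ENNReal.ofReal (g x) ∂μ) ≤ ENNReal.ofReal (∫ x, h x ∂μ) := by
    rw [ofReal_integral_eq_lintegral_ofReal hh (Eventually.of_forall h0)]
    exact lintegral_mono fun x => ENNReal.ofReal_le_ofReal (hgh x)
  rw [extIntegral]
  refine (EReal.sub_le_sub (EReal.coe_ennreal_le_coe_ennreal_iff.2 h1)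
    (EReal.coe_ennreal_nonneg _)).trans ?_
  rw [sub_zero, EReal.coe_ennreal_ofReal, max_eq_left (integral_nonneg h0)]

/-- The inequality of order `p` implies the inequalities of order `r ∈ (2, p]`. -/
theorem LogSobolev.real_of_le (hJ : IsLevyKernel J) (hr : 2 < r) (hrp : r ≤ p)
    (h : LogSobolev J p C D) : RealLogSobolev J r C (D * (p ^ 2 / 4)) := by
  intro w hw hj
  have hp0 : 0 < p := by linarith
  -- This power satisfies `f^p = |w|^r` and `f^(p/2) = |w|^(r/2)`. Its energy of order `p` is at
  -- most the quadratic energy of `|w|^(r/2)`, hence at most `r²/4 ≤ p²/4` times the energy of order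
  -- `r` of `w`.
  let f : Space N → ℝ := fun x => |w x| ^ (r / p)
  have hf : Measurable f := (measurable_abs_rpow _).comp (Lp.stronglyMeasurable w).measurable
  have hf0 : ∀ x, 0 ≤ f x := fun x => Real.rpow_nonneg (abs_nonneg _) _
  have hpow : ∀ s x, f x ^ s = |w x| ^ (r / p * s) := fun s x =>
    (Real.rpow_mul (abs_nonneg _) _ _).symm
  have hp1 : ∀ x, |f x| ^ p = |w x| ^ r := fun x => by
    rw [abs_of_nonneg (hf0 x), hpow]
    congr 1; field_simp
  have hp2 : ∀ x, |f x| ^ (p / 2) = |w x| ^ (r / 2) := fun x => by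
    rw [abs_of_nonneg (hf0 x), hpow]
    congr 1; field_simp
  have hP : ∀ x, Phi (|w x| ^ r) = r * (|w x| ^ r * Real.log |w x|) := fun x =>
    Phi_abs_rpow (by linarith) _
  let e : Space N × Space N → ℝ := fun z => jump (fun v => oddPow r (w v)) z * jump w z
  have he0 : ∀ z, 0 ≤ e z := jump_oddPow_mul_jump_nonneg hr.le _
  have hei : Integrable e (jumpMeasure J) := (memLp_jump_oddPow hr.le hw hj).integrable_mul hj
  have hform : dirichletForm J (fun x => |f x| ^ (p - 2) * f x) f
      ≤ ((∫ z, p ^ 2 / 4 * e z ∂jumpMeasure J : ℝ) : EReal) := by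
    rw [dirichletForm_eq hJ]
    refine extIntegral_le (fun z => ?_) (fun z => mul_nonneg (by positivity) (he0 z))
      (hei.const_mul _)
    have e1 := oddPow_sub_mul_sub_le (by linarith : 2 ≤ p) (hf0 z.1) (hf0 z.2)
    have e2 := sq_abs_rpow_half_sub_le hr.le (w z.1) (w z.2)
    rw [← hp2, ← hp2, abs_of_nonneg (hf0 z.1), abs_of_nonneg (hf0 z.2)] at e2
    refine (e1.trans e2).trans (mul_le_mul_of_nonneg_right ?_ (he0 z))
    have : r ^ 2 ≤ p ^ 2 := pow_le_pow_left₀ (by linarith) hrp 2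
    linarith
  have hE : MemEnergySpace J fun x => |f x| ^ (p / 2) := by
    simp_rw [hp2]
    exact memEnergySpace_abs_rpow_half hJ hr.le hw hj
  have h1 := h.integral_le hf hE
    (by simp_rw [hp1, hP]; exact (integrable_abs_rpow_mul_log hr hw).const_mul r) hform
  simp_rw [hp1, hP, integral_const_mul, ← mul_assoc D] at h1
  exact h1

end LogSobolev

/-! ### Absolute continuity by comparison of increments. -/

section AbsolutelyContinuous

theorem absolutelyContinuousOnInterval_of_dist_le {f g : ℝ → ℝ} {a b K : ℝ}
    (hg : AbsolutelyContinuousOnInterval g a b)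
    (h : ∀ x ∈ uIcc a b, ∀ y ∈ uIcc a b, dist (f x) (f y) ≤ K * dist (g x) (g y)) :
    AbsolutelyContinuousOnInterval f a b := by
  have hlim : Tendsto (fun E : ℕ × (ℕ → ℝ × ℝ) =>
      K * ∑ i ∈ Finset.range E.1, dist (g (E.2 i).1) (g (E.2 i).2))
      (AbsolutelyContinuousOnInterval.totalLengthFilter ⊓
        𝓟 (AbsolutelyContinuousOnInterval.disjWithin a b)) (𝓝 0) := by
    simpa using Tendsto.const_mul K hg
  refine squeeze_zero' (Eventually.of_forall fun E => Finset.sum_nonneg fun i _ => dist_nonneg) ?_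
    hlim
  filter_upwards [mem_inf_of_right (mem_principal_self _)] with E hE
  rw [Finset.mul_sum]
  exact Finset.sum_le_sum fun i hi => h _ (hE.1 i hi).1 _ (hE.1 i hi).2

end AbsolutelyContinuous

/-! ### Gross' differential inequality along a path of exponents. -/

section Path

variable {J : Space N → Space N → ℝ} {r s ε R : ℝ}

theorem integral_abs_rpow_pos {f : L2 N} (hr : 2 ≤ r) (hf : ∀ᵐ v, |f v| ≤ 1) (h0 : f ≠ 0) :
    0 < ∫ v, |f v| ^ r := by
  have hnn : ∀ v, 0 ≤ |f v| ^ r := fun v => Real.rpow_nonneg (abs_nonneg _) _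
  refine (integral_nonneg hnn).lt_of_ne fun h => h0 ?_
  have h1 := (integral_eq_zero_iff_of_nonneg hnn (integrable_abs_rpow hr hf)).1 h.symm
  rw [Lp.eq_zero_iff_ae_eq_zero]
  filter_upwards [h1] with v hv
  simpa using (Real.rpow_eq_zero_iff_of_nonneg (abs_nonneg _)).1 hv |>.1

theorem abs_mul_oddPow_le (hr : r ∈ Icc (2 + ε) R) (hε : 0 < ε) {a : ℝ} (ha : |a| ≤ 1) :
    |r * oddPow r a| ≤ taylorConst ε R * |a| := by
  have hr0 : 0 ≤ r := by linarith [hr.1]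
  rw [abs_mul, abs_of_nonneg hr0]
  exact mul_le_mul (hr.2.trans (le_taylorConst hε (by linarith [hr.1, hr.2])).2.1)
    (abs_oddPow_le ha (by linarith [hr.1])) (abs_nonneg _)
    (by linarith [(le_taylorConst hε (by linarith [hr.1, hr.2] : 2 ≤ R)).1])

theorem abs_rpow_mul_log_le_taylorConst (hr : r ∈ Icc (2 + ε) R) (hε : 0 < ε) {a : ℝ}
    (ha : |a| ≤ 1) : |(|a| ^ r * Real.log |a|)| ≤ taylorConst ε R * a ^ 2 :=
  (abs_rpow_mul_log_le hε ha hr.1).trans (mul_le_mul_of_nonneg_right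
    (le_taylorConst hε (by linarith [hr.1, hr.2])).2.2 (sq_nonneg _))

theorem abs_abs_rpow_le_taylorConst (hr : r ∈ Icc (2 + ε) R) (hε : 0 < ε) {a : ℝ}
    (ha : |a| ≤ 1) : |(|a| ^ r)| ≤ taylorConst ε R * a ^ 2 :=
  (abs_abs_rpow_le_sq (by linarith [hr.1]) ha).trans (mul_le_mul_of_nonneg_right
    (le_taylorConst hε (by linarith [hr.1, hr.2])).1 (sq_nonneg _))

/-- Lipschitz bound for `(r, f) ↦ ∫ |f|^r`. -/
theorem abs_integral_rpow_sub_le (hε : 0 < ε) (hr : r ∈ Icc (2 + ε) R) (hs : s ∈ Icc (2 + ε) R)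
    {f g : L2 N} (hf : ∀ᵐ v, |f v| ≤ 1) (hg : ∀ᵐ v, |g v| ≤ 1) {B : ℝ} (hfB : ‖f‖ ≤ B)
    (hgB : ‖g‖ ≤ B) :
    |(∫ v, |g v| ^ s) - ∫ v, |f v| ^ r|
      ≤ taylorConst ε R * (3 * B * ‖g - f‖ + (1 + R) * B ^ 2 * |s - r|) := by
  have hR : 2 ≤ R := by linarith [hr.1, hr.2]
  set K := taylorConst ε R with hKdef
  have hK : 0 ≤ K := by linarith [(le_taylorConst hε hR).1]
  have hB : 0 ≤ B := (norm_nonneg f).trans hfB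
  let S : Set ℝ := {a | |a| ≤ 1}
  have bψ : ∀ a ∈ S, |r * oddPow r a| ≤ K * |a| := fun a ha => abs_mul_oddPow_le hr hε ha
  have bχ : ∀ a ∈ S, |(|a| ^ r * Real.log |a|)| ≤ K * a ^ 2 := fun a ha =>
    abs_rpow_mul_log_le_taylorConst hr hε ha
  have h1 := abs_integral_comp_sub_le (Φ := fun a => |a| ^ r) (Φ' := fun a => |a| ^ s)
    (ψ := fun a => r * oddPow r a) (χ := fun a => |a| ^ r * Real.log |a|) (S := S) (K := K)
    (δ := s - r) (measurable_abs_rpow r) (measurable_abs_rpow s) ((measurable_oddPow r).const_mul r)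
    (measurable_abs_rpow_mul_log r) (fun a ha => abs_abs_rpow_le_taylorConst hr hε ha)
    (fun a ha => abs_abs_rpow_le_taylorConst hs hε ha) bψ bχ
    (fun a ha b hb => abs_rpow_joint_taylor_le hε hr hs ha hb) f g hf hg
  have h2 := abs_integral_comp_mul_le (ψ := fun a => r * oddPow r a)
    ((measurable_oddPow r).const_mul r) bψ f (g - f) hf
  have h3 : |∫ v, |f v| ^ r * Real.log (|f v|)| ≤ K * ‖f‖ ^ 2 := by
    rw [norm_sq_eq_integral, ← integral_const_mul]
    refine abs_integral_le_integral_abs.trans (integral_mono_ae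
      (integrable_comp (measurable_abs_rpow_mul_log r) bχ f hf).abs
      ((Lp.memLp f).integrable_sq.const_mul _) ?_)
    filter_upwards [hf] with v hv using bχ _ hv
  set d := ‖g - f‖ with hd
  have hd0 : 0 ≤ d := norm_nonneg _
  have hd1 : d ≤ 2 * B := (norm_sub_le _ _).trans (by linarith)
  have hf2 : ‖f‖ ^ 2 ≤ B ^ 2 := pow_le_pow_left₀ (norm_nonneg _) hfB 2
  have hsr : |s - r| ≤ R := abs_le.2 ⟨by linarith [hs.1, hr.2], by linarith [hs.2, hr.1]⟩
  have hsr0 := abs_nonneg (s - r)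
  set A := ∫ v, r * oddPow r (f v) * (g - f) v
  set X := ∫ v, |f v| ^ r * Real.log |f v|
  have e1 : (∫ v, |g v| ^ s) - ∫ v, |f v| ^ r
      = ((∫ v, |g v| ^ s) - (∫ v, |f v| ^ r) - A - (s - r) * X) + A + (s - r) * X := by ring
  rw [e1]
  refine (abs_add_three _ _ _).trans ?_
  have b1 : |A| ≤ K * (B * d) := by
    refine h2.trans ?_
    rw [mul_assoc]
    gcongr
  have b2 : |(s - r) * X| ≤ K * (B ^ 2 * |s - r|) := by
    rw [abs_mul]
    calc |s - r| * |X| ≤ |s - r| * (K * B ^ 2) := by gcongr; exact h3.trans (by gcongr)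
      _ = _ := by ring
  have b3 : K * (d ^ 2 + (s - r) ^ 2 * ‖f‖ ^ 2) ≤ K * (2 * B * d + R * B ^ 2 * |s - r|) := by
    refine mul_le_mul_of_nonneg_left (add_le_add ?_ ?_) hK
    · rw [sq]; gcongr
    · rw [← sq_abs (s - r), sq |s - r|]
      calc |s - r| * |s - r| * ‖f‖ ^ 2 ≤ R * |s - r| * B ^ 2 := by gcongr
        _ = _ := by ring
  refine (add_le_add (add_le_add (h1.trans b3) b1) b2).trans (le_of_eq ?_)
  ring

/-- A solution of the evolution equation, together with the bounds used in Gross' argument. -/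
structure IsBoundedSolution (J : Space N → Space N → ℝ) (V W : ℝ → L2 N) (B L : ℝ) : Prop where
  hasDerivAt : ∀ t, 0 < t → HasDerivAt V (-W t) t
  formRel : ∀ t, 0 < t → FormRel (jumpGraph J) (V t) (W t)
  abs_le_one : ∀ t, 0 < t → ∀ᵐ v, |V t v| ≤ 1
  norm_le : ∀ t, 0 < t → ‖V t‖ ≤ B
  norm_deriv_le : ∀ t, 0 < t → ‖W t‖ ≤ L

variable {V W : ℝ → L2 N} {B L : ℝ}

theorem IsBoundedSolution.norm_sub_le (h : IsBoundedSolution J V W B L) {t u : ℝ} (ht : 0 < t)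
    (hu : 0 < u) : ‖V u - V t‖ ≤ L * |u - t| :=
  Convex.norm_image_sub_le_of_norm_hasDerivWithin_le (s := Ioi 0)
    (fun x hx => (h.hasDerivAt x hx).hasDerivWithinAt)
    (fun x hx => by rw [norm_neg]; exact h.norm_deriv_le x hx) (convex_Ioi 0) ht hu

/-- The derivative of `∫ |V(τ(r))|^r` along a path `τ`. -/
theorem IsBoundedSolution.hasDerivAt_integral_rpow (h : IsBoundedSolution J V W B L) (hε : 0 < ε)
    (hr : r ∈ Ioo (2 + ε) R) {τ : ℝ → ℝ} {d : ℝ} (hτ : HasDerivAt τ d r)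
    (hpos : ∀ s ∈ Icc (2 + ε) R, 0 < τ s) :
    HasDerivAt (fun s => ∫ v, |V (τ s) v| ^ s)
      ((∫ v, |V (τ r) v| ^ r * Real.log |V (τ r) v|)
        - d * r * ∫ z, jump (fun v => oddPow r (V (τ r) v)) z * jump (V (τ r)) z ∂jumpMeasure J)
      r := by
  have hr' : r ∈ Icc (2 + ε) R := Ioo_subset_Icc_self hr
  have hr2 : 2 ≤ r := by linarith [hr.1]
  have hev : ∀ᶠ s in 𝓝 r, s ∈ Icc (2 + ε) R := Icc_mem_nhds hr.1 hr.2
  have hτr := hpos r hr'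
  have hw : HasDerivAt (fun s => V (τ s)) (d • -W (τ r)) r :=
    (h.hasDerivAt _ hτr).scomp r hτ
  have hb := h.abs_le_one _ hτr
  have h1 := hasDerivAt_integral_comp (Ψ := fun s a => |a| ^ s) (ψ := fun a => r * oddPow r a)
    (χ := fun a => |a| ^ r * Real.log |a|) (S := {a | |a| ≤ 1}) (K := taylorConst ε R)
    measurable_abs_rpow ((measurable_oddPow r).const_mul r) (measurable_abs_rpow_mul_log r)
    (hev.mono fun s hs a ha => abs_abs_rpow_le_taylorConst hs hε ha)
    (fun a ha => abs_mul_oddPow_le hr' hε ha)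
    (fun a ha => abs_rpow_mul_log_le_taylorConst hr' hε ha)
    (hev.mono fun s hs a ha b hb => abs_rpow_joint_taylor_le hε hr' hs ha hb) hw
    (hev.mono fun s hs => h.abs_le_one _ (hpos s hs))
  convert h1 using 1
  have hA := h.formRel _ hτr
  have h2 := hA.integral_eq (memLp_oddPow hr2 hb) (memLp_jump_oddPow hr2 hb hA.memLp_jump)
  have h3 : ∫ v, r * oddPow r (V (τ r) v) * (d • -W (τ r)) v
      = -(d * r) * ∫ v, W (τ r) v * oddPow r (V (τ r) v) := by
    rw [← integral_const_mul]
    refine integral_congr_ae ?_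
    filter_upwards [Lp.coeFn_smul d (-W (τ r)), Lp.coeFn_neg (W (τ r))] with v e1 e2
    rw [e1, Pi.smul_apply, e2, Pi.neg_apply, smul_eq_mul]
    ring
  rw [h3, h2]
  simp_rw [mul_comm (jump (V (τ r)) _)]
  ring

/-- Gross' argument: the norm of order `r` along the path with velocity `D(r) / r²`. -/
theorem IsBoundedSolution.log_integral_rpow_le (h : IsBoundedSolution J V W B L) (hε : 0 < ε)
    (hR : 2 + ε ≤ R) {c d : ℝ → ℝ} (hc : IntervalIntegrable c volume (2 + ε) R)
    (hd : IntervalIntegrable d volume (2 + ε) R) (hd0 : ∀ r ∈ Icc (2 + ε) R, 0 ≤ d r)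
    (hLS : ∀ r ∈ Icc (2 + ε) R, RealLogSobolev J r (c r * r ^ 2) (d r * r ^ 2)) {T : ℝ}
    (hT : 0 < T) (hne : ∀ t, 0 < t → t ≤ T + ∫ r in (2 + ε)..R, d r → V t ≠ 0) :
    Real.log (∫ v, |V (T + ∫ r in (2 + ε)..R, d r) v| ^ R) / R
      ≤ Real.log (∫ v, |V T v| ^ (2 + ε)) / (2 + ε) + ∫ r in (2 + ε)..R, c r := by
  set a := 2 + ε with ha
  let τ : ℝ → ℝ := fun r => T + ∫ x in a..r, d x
  have hsub : ∀ r ∈ Icc a R, ∀ s ∈ Icc a R, IntervalIntegrable d volume r s := fun r hr s hs =>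
    hd.mono_set (by rw [uIcc_of_le hR]; exact uIcc_subset_Icc hr hs)
  have haI : a ∈ Icc a R := left_mem_Icc.2 hR
  have hτsub : ∀ r ∈ Icc a R, ∀ s ∈ Icc a R, τ s - τ r = ∫ x in r..s, d x := fun r hr s hs => by
    rw [← intervalIntegral.integral_interval_sub_left (hsub a haI s hs) (hsub a haI r hr)]
    simp only [τ]; ring
  have hτmono : MonotoneOn τ (Icc a R) := fun r hr s hs hrs => by
    rw [← sub_nonneg, hτsub r hr s hs]
    exact intervalIntegral.integral_nonneg hrs fun u hu =>
      hd0 u ⟨hr.1.trans hu.1, hu.2.trans hs.2⟩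
  have hτa : τ a = T := by simp [τ]
  have hτpos : ∀ r ∈ Icc a R, 0 < τ r := fun r hr => by
    have := hτmono haI hr hr.1
    linarith
  have hτle : ∀ r ∈ Icc a R, τ r ≤ τ R := fun r hr => hτmono hr (right_mem_Icc.2 hR) hr.2
  let n : ℝ → ℝ := fun r => ∫ v, |V (τ r) v| ^ r
  have hB : 0 ≤ B := (norm_nonneg _).trans (h.norm_le T hT)
  have hL : 0 ≤ L := (norm_nonneg _).trans (h.norm_deriv_le T hT)
  have hK : 0 ≤ taylorConst ε R := by linarith [(le_taylorConst hε (by linarith : 2 ≤ R)).1]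
  have hnpos : ∀ r ∈ Icc a R, 0 < n r := fun r hr =>
    integral_abs_rpow_pos (by linarith [hr.1]) (h.abs_le_one _ (hτpos r hr))
      (hne _ (hτpos r hr) (hτle r hr))
  have hτac : AbsolutelyContinuousOnInterval τ a R := by
    refine absolutelyContinuousOnInterval_of_dist_le (K := 1)
      (hd.absolutelyContinuousOnInterval_intervalIntegral left_mem_uIcc) fun x _ y _ => ?_
    simp only [τ]
    rw [dist_add_left, one_mul]
  have hidac : AbsolutelyContinuousOnInterval (fun r : ℝ => r) a R :=
    (LipschitzWith.id.lipschitzOnWith (s := uIcc a R)).absolutelyContinuousOnInterval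
  -- Both summands are nondecreasing, so the increments of `τ r + r` dominate those of `τ` and of
  -- `r`; one absolutely continuous function then controls `n`.
  have hgac : AbsolutelyContinuousOnInterval (fun r => τ r + r) a R := hτac.add hidac
  have hdist : ∀ x ∈ Icc a R, ∀ y ∈ Icc a R,
      |x - y| ≤ dist (τ x + x) (τ y + y) ∧ |τ x - τ y| ≤ dist (τ x + x) (τ y + y) := by
    intro x hx y hy
    rw [Real.dist_eq]
    rcases le_total x y with hxy | hxy
    · have := hτmono hx hy hxy
      rw [abs_of_nonpos (by linarith), abs_of_nonpos (by linarith), abs_of_nonpos (by linarith)]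
      constructor <;> linarith
    · have := hτmono hy hx hxy
      rw [abs_of_nonneg (by linarith), abs_of_nonneg (by linarith), abs_of_nonneg (by linarith)]
      constructor <;> linarith
  have hnac : AbsolutelyContinuousOnInterval n a R := by
    refine absolutelyContinuousOnInterval_of_dist_le
      (K := taylorConst ε R * (3 * B * L + (1 + R) * B ^ 2)) hgac fun x hx y hy => ?_
    rw [uIcc_of_le hR] at hx hy
    have e1 := abs_integral_rpow_sub_le hε hy hx (h.abs_le_one _ (hτpos y hy))
      (h.abs_le_one _ (hτpos x hx)) (h.norm_le _ (hτpos y hy)) (h.norm_le _ (hτpos x hx))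
    have e2 := h.norm_sub_le (hτpos y hy) (hτpos x hx)
    obtain ⟨e3, e4⟩ := hdist x hx y hy
    have hR0 : 0 ≤ 1 + R := by linarith
    refine e1.trans ?_
    rw [mul_assoc (taylorConst ε R)]
    refine mul_le_mul_of_nonneg_left ?_ hK
    rw [add_mul (3 * B * L)]
    refine add_le_add ?_ (mul_le_mul_of_nonneg_left e3 (by positivity))
    rw [mul_assoc (3 * B)]
    exact mul_le_mul_of_nonneg_left (e2.trans (mul_le_mul_of_nonneg_left e4 hL)) (by positivity)
  -- The positive minimum of `n` makes the logarithm Lipschitz on its range.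
  obtain ⟨x₀, hx₀, hmin⟩ := isCompact_Icc.exists_isMinOn (nonempty_Icc.2 hR)
    (by rw [← uIcc_of_le hR]; exact hnac.continuousOn : ContinuousOn n (Icc a R))
  have hlogac : AbsolutelyContinuousOnInterval (fun r => Real.log (n r)) a R := by
    have hm := hnpos x₀ hx₀
    refine absolutelyContinuousOnInterval_of_dist_le (K := (n x₀)⁻¹) hnac fun x hx y hy => ?_
    rw [uIcc_of_le hR] at hx hy
    exact Convex.norm_image_sub_le_of_norm_hasDerivWithin_le (s := Ici (n x₀))
      (fun z hz => (Real.hasDerivAt_log (hm.trans_le hz).ne').hasDerivWithinAt)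
      (fun z hz => by
        rw [Real.norm_of_nonneg (inv_nonneg.2 (hm.le.trans hz))]
        exact inv_anti₀ hm hz) (convex_Ici _) (hmin hy) (hmin hx)
  have hinvac : AbsolutelyContinuousOnInterval (fun r : ℝ => r⁻¹) a R := by
    refine absolutelyContinuousOnInterval_of_dist_le (K := 1) hidac fun x hx y hy => ?_
    rw [uIcc_of_le hR] at hx hy
    have hx1 : 1 ≤ x := by linarith [hx.1]
    have hy1 : 1 ≤ y := by linarith [hy.1]
    rw [Real.dist_eq, Real.dist_eq, inv_sub_inv (by linarith) (by linarith), abs_div, one_mul,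
      abs_sub_comm, abs_of_nonneg (by positivity : 0 ≤ x * y)]
    exact div_le_self (abs_nonneg _) (by nlinarith)
  let Λ : ℝ → ℝ := fun r => Real.log (n r) * r⁻¹
  have hΛac : AbsolutelyContinuousOnInterval Λ a R := hlogac.mul hinvac
  have hderiv : ∀ᵐ r, r ∈ Ioo a R → deriv Λ r ≤ c r := by
    filter_upwards [hd.ae_hasDerivAt_integral] with r hr hrI
    have hrI' : r ∈ Icc a R := Ioo_subset_Icc_self hrI
    have hr0 : 0 < r := by linarith [hrI.1]
    have hτd : HasDerivAt τ (d r) r :=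
      (hr (by rwa [uIcc_of_le hR]) a left_mem_uIcc).const_add T
    have hnd := h.hasDerivAt_integral_rpow hε hrI hτd hτpos
    have hn := hnpos r hrI'
    have hΛd : HasDerivAt Λ _ r := (hnd.log hn.ne').mul (hasDerivAt_inv hr0.ne')
    rw [hΛd.deriv]
    have hls := hLS r hrI' (V (τ r)) (h.abs_le_one _ (hτpos r hrI'))
      (h.formRel _ (hτpos r hrI')).memLp_jump
    change _ / n r * r⁻¹ + Real.log (n r) * _ ≤ c r
    set X := ∫ v, |V (τ r) v| ^ r * Real.log |V (τ r) v|
    set E := ∫ z, jump (fun v => oddPow r (V (τ r) v)) z * jump (V (τ r)) z ∂jumpMeasure J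
    have hls' : r * X - n r * Real.log (n r) ≤ c r * r ^ 2 * n r + d r * r ^ 2 * E := hls
    -- In `r² n Λ'` the energy enters with coefficient `-d r * r²`, exactly what the logarithmic
    -- Sobolev inequality allows; `c r * r² * n` remains.
    have e1 : (X - d r * r * E) / n r * r⁻¹ + Real.log (n r) * -(r ^ 2)⁻¹
        = (r * X - n r * Real.log (n r) - d r * r ^ 2 * E) / (r ^ 2 * n r) := by
      field_simp
      ring
    rw [e1, div_le_iff₀ (by positivity)]
    linarith
  have hfin : ∫ r in a..R, deriv Λ r ≤ ∫ r in a..R, c r := by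
    refine intervalIntegral.integral_mono_ae_restrict hR hΛac.intervalIntegrable_deriv hc ?_
    rw [← restrict_Ioo_eq_restrict_Icc]
    exact (ae_restrict_iff' measurableSet_Ioo).2 hderiv
  rw [hΛac.integral_deriv_eq_sub] at hfin
  have e1 : Λ R = Real.log (∫ v, |V (T + ∫ r in a..R, d r) v| ^ R) / R :=
    (div_eq_mul_inv _ _).symm
  have e2 : Λ a = Real.log (∫ v, |V T v| ^ a) / a := by
    rw [div_eq_mul_inv, ← hτa]
  rw [← e1, ← e2]
  linarith

end Path

/-! ### From `L^r` bounds to a sup bound. -/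

section SupBound

variable {J : Space N → Space N → ℝ} {V W : ℝ → L2 N} {B L M T : ℝ} {c d : ℝ → ℝ}

theorem integral_abs_rpow_le_norm_sq {r : ℝ} (hr : 2 ≤ r) {f : L2 N} (hf : ∀ᵐ v, |f v| ≤ 1) :
    ∫ v, |f v| ^ r ≤ ‖f‖ ^ 2 := by
  rw [norm_sq_eq_integral]
  refine integral_mono_ae (integrable_abs_rpow hr hf) (Lp.memLp f).integrable_sq ?_
  filter_upwards [hf] with v hv using abs_rpow_le_sq hv hr

/-- Differentiation needs orders above 2, so the path starts at order `2 + ε`, where `|V| ≤ 1`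
bounds the integral by the squared `L²` norm, and then `ε → 0`. -/
theorem IsBoundedSolution.log_integral_rpow_le_of_tendsto (h : IsBoundedSolution J V W B L)
    {R : ℝ} (hR : 2 < R) (hc : IntervalIntegrable c volume 2 R) (hd : IntegrableOn d (Ioi 2))
    (hd0 : ∀ r, 2 < r → 0 ≤ d r)
    (hLS : ∀ r, 2 < r → RealLogSobolev J r (c r * r ^ 2) (d r * r ^ 2))
    (hT : ∫ r in Ioi 2, d r < T) (hne : ∀ t, 0 < t → t ≤ T → V t ≠ 0) :
    Real.log (∫ v, |V T v| ^ R) / R ≤ Real.log B + ∫ r in (2 : ℝ)..R, c r := by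
  have hT0 : 0 < T := (setIntegral_nonneg measurableSet_Ioi hd0).trans_lt hT
  have hcI : IntegrableOn c (uIcc 2 R) := by
    rw [uIcc_of_le hR.le]; exact (intervalIntegrable_iff_integrableOn_Icc_of_le hR.le).1 hc
  have hprim := intervalIntegral.continuousOn_primitive_interval hcI
  rw [uIcc_of_le hR.le] at hprim
  have hstep : ∀ ε ∈ Ioo 0 (R - 2), Real.log (∫ v, |V T v| ^ R) / R
      ≤ Real.log (B ^ 2) / (2 + ε) + ((∫ r in (2 : ℝ)..R, c r) - ∫ r in (2 : ℝ)..(2 + ε), c r) := by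
    intro ε hε
    have hεR : 2 + ε ≤ R := by linarith [hε.2]
    have hsub : uIcc (2 + ε) R ⊆ uIcc 2 R := by
      rw [uIcc_of_le hR.le, uIcc_of_le hεR]
      exact Icc_subset_Icc_left (by linarith [hε.1])
    have hsub' : uIcc 2 (2 + ε) ⊆ uIcc 2 R := by
      rw [uIcc_of_le hR.le, uIcc_of_le (by linarith [hε.1])]
      exact Icc_subset_Icc_right hεR
    have hdε : IntervalIntegrable d volume (2 + ε) R := by
      rw [intervalIntegrable_iff_integrableOn_Ioc_of_le hεR]
      exact hd.mono_set fun x hx => lt_of_le_of_lt (by linarith [hε.1]) hx.1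
    have hdle : ∫ r in (2 + ε)..R, d r ≤ ∫ r in Ioi 2, d r := by
      rw [intervalIntegral.integral_of_le hεR]
      refine setIntegral_mono_set hd ?_ ?_
      · exact (ae_restrict_iff' measurableSet_Ioi).2 (Eventually.of_forall hd0)
      · exact Eventually.of_forall fun x hx => lt_of_le_of_lt (by linarith [hε.1]) hx.1
    -- The starting time is chosen so that the path ends exactly at `T`; it is positive because `T`
    -- exceeds the whole integral of `d`.
    have h1 := h.log_integral_rpow_le hε.1 hεR (hc.mono_set hsub) hdε
      (fun r hr => hd0 r (by linarith [hr.1, hε.1])) (fun r hr => hLS r (by linarith [hr.1, hε.1]))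
      (T := T - ∫ r in (2 + ε)..R, d r) (by linarith)
      (by rw [sub_add_cancel]; exact hne)
    rw [sub_add_cancel] at h1
    have hT1 : 0 < T - ∫ r in (2 + ε)..R, d r := by linarith
    have hT2 : T - ∫ r in (2 + ε)..R, d r ≤ T := by
      have : 0 ≤ ∫ r in (2 + ε)..R, d r :=
        intervalIntegral.integral_nonneg hεR fun r hr => hd0 r (by linarith [hr.1, hε.1])
      linarith
    set V₁ := V (T - ∫ r in (2 + ε)..R, d r)
    have h2 : Real.log (∫ v, |V₁ v| ^ (2 + ε)) ≤ Real.log (B ^ 2) := by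
      refine Real.log_le_log (integral_abs_rpow_pos (by linarith [hε.1]) (h.abs_le_one _ hT1)
        (hne _ hT1 hT2)) ((integral_abs_rpow_le_norm_sq (by linarith [hε.1])
        (h.abs_le_one _ hT1)).trans (pow_le_pow_left₀ (norm_nonneg _) (h.norm_le _ hT1) 2))
    have h3 : (∫ r in (2 : ℝ)..R, c r) - ∫ r in (2 : ℝ)..(2 + ε), c r
        = ∫ r in (2 + ε)..R, c r :=
      intervalIntegral.integral_interval_sub_left hc (hc.mono_set hsub')
    rw [h3]
    have h4 : 0 < 2 + ε := by linarith [hε.1]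
    exact h1.trans (add_le_add (div_le_div_of_nonneg_right h2 h4.le) le_rfl)
  have hlim : Tendsto (fun ε : ℝ => Real.log (B ^ 2) / (2 + ε)
      + ((∫ r in (2 : ℝ)..R, c r) - ∫ r in (2 : ℝ)..(2 + ε), c r)) (𝓝[>] 0)
      (𝓝 (Real.log (B ^ 2) / (2 + 0)
        + ((∫ r in (2 : ℝ)..R, c r) - ∫ r in (2 : ℝ)..2, c r))) := by
    have hadd : Tendsto (fun ε : ℝ => 2 + ε) (𝓝[>] 0) (𝓝[Icc 2 R] 2) := by
      refine tendsto_nhdsWithin_iff.2 ⟨?_, ?_⟩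
      · have : Tendsto (fun ε : ℝ => 2 + ε) (𝓝 0) (𝓝 (2 + 0)) := tendsto_const_nhds.add tendsto_id
        rw [add_zero] at this
        exact this.mono_left nhdsWithin_le_nhds
      · filter_upwards [Ioo_mem_nhdsGT (sub_pos.2 hR)] with ε hε
        exact ⟨by linarith [hε.1], by linarith [hε.2]⟩
    refine Tendsto.add (Tendsto.div tendsto_const_nhds ?_ (by norm_num)) (tendsto_const_nhds.sub ?_)
    · exact (tendsto_const_nhds.add tendsto_id).mono_left nhdsWithin_le_nhds
    · exact (hprim 2 (left_mem_Icc.2 hR.le)).tendsto.comp hadd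
  have h5 := ge_of_tendsto hlim (by
    filter_upwards [Ioo_mem_nhdsGT (sub_pos.2 hR)] with ε hε using hstep ε hε)
  rw [add_zero, intervalIntegral.integral_same, sub_zero, Real.log_pow] at h5
  refine h5.trans (le_of_eq ?_)
  push_cast
  ring

/-- A function whose `L^r` norms are bounded by `Q` for large `r` is essentially bounded by `Q`. -/
theorem ae_abs_le_of_integral_rpow_le {f : L2 N} (hf : ∀ᵐ v, |f v| ≤ 1) {Q : ℝ} (hQ : 0 ≤ Q)
    (h : ∀ᶠ n : ℕ in atTop, ∫ v, |f v| ^ (n : ℝ) ≤ Q ^ n) : ∀ᵐ v, |f v| ≤ Q := by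
  have key : ∀ A, Q < A → ∀ᵐ v, |f v| < A := by
    intro A hA
    have hA0 : 0 < A := hQ.trans_lt hA
    have hmeas : ∀ n : ℕ, n ≠ 0 → {v | A ≤ |f v|} = {v | A ^ n ≤ |f v| ^ (n : ℝ)} := fun n hn => by
      ext v
      simp only [mem_ofPred_eq, Real.rpow_natCast]
      exact (pow_le_pow_iff_left₀ hA0.le (abs_nonneg _) hn).symm
    have hfin : volume {v | A ≤ |f v|} < ∞ := by
      rw [hmeas 2 two_ne_zero]
      exact (integrable_abs_rpow (r := (2 : ℕ)) (by norm_num) hf).measure_ge_lt_top (pow_pos hA0 2)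
    -- Chebyshev's inequality in `L^n`; the right side tends to zero because `Q < A`.
    have hb : ∀ᶠ n : ℕ in atTop, volume.real {v | A ≤ |f v|} ≤ (Q / A) ^ n := by
      filter_upwards [h, eventually_ge_atTop 2] with n hn hn2
      have h1 := mul_meas_ge_le_integral_of_nonneg
        (Eventually.of_forall fun v => Real.rpow_nonneg (abs_nonneg (f v)) (n : ℝ))
        (integrable_abs_rpow (by exact_mod_cast hn2) hf) (A ^ n)
      rw [← hmeas n (by omega)] at h1
      rw [div_pow, le_div_iff₀ (pow_pos hA0 n), mul_comm]
      exact h1.trans hn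
    have hlim : Tendsto (fun n : ℕ => (Q / A) ^ n) atTop (𝓝 0) :=
      tendsto_pow_atTop_nhds_zero_of_lt_one (by positivity) ((div_lt_one hA0).2 hA)
    have h0 : volume.real {v | A ≤ |f v|} = 0 :=
      le_antisymm (ge_of_tendsto hlim hb) measureReal_nonneg
    rw [measureReal_eq_zero_iff hfin.ne] at h0
    rw [ae_iff]
    simpa only [not_lt] using h0
  have hall : ∀ᵐ v, ∀ n : ℕ, |f v| < Q + 1 / ((n : ℝ) + 1) :=
    ae_all_iff.2 fun n => key _ (by have := Nat.one_div_pos_of_nat (α := ℝ) (n := n); linarith)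
  filter_upwards [hall] with v hv
  have hlim : Tendsto (fun n : ℕ => Q + 1 / ((n : ℝ) + 1)) atTop (𝓝 (Q + 0)) :=
    tendsto_const_nhds.add tendsto_one_div_add_atTop_nhds_zero_nat
  rw [add_zero] at hlim
  exact ge_of_tendsto hlim (Eventually.of_forall fun n => (hv n).le)

theorem IsBoundedSolution.ae_abs_le (h : IsBoundedSolution J V W B L)
    (hanti : AntitoneOn (fun t => ‖V t‖) (Ici 0))
    (hc : ∀ R, 2 ≤ R → IntervalIntegrable c volume 2 R)
    (hcM : ∀ᶠ R in atTop, ∫ r in (2 : ℝ)..R, c r ≤ M) (hd : IntegrableOn d (Ioi 2))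
    (hd0 : ∀ r, 2 < r → 0 ≤ d r)
    (hLS : ∀ r, 2 < r → RealLogSobolev J r (c r * r ^ 2) (d r * r ^ 2))
    (hT : ∫ r in Ioi 2, d r < T) : ∀ᵐ v, |V T v| ≤ Real.exp M * B := by
  have hT0 : 0 < T := (setIntegral_nonneg measurableSet_Ioi hd0).trans_lt hT
  have hB : ‖V T‖ ≤ B := h.norm_le T hT0
  have hB0 : 0 ≤ B := (norm_nonneg _).trans hB
  -- If `V T ≠ 0`, monotonicity of the norm excludes zeros before `T`, so the logarithms along the
  -- path make sense.
  by_cases hVT : V T = 0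
  · rw [hVT]
    filter_upwards [Lp.coeFn_zero ℝ 2 (volume : Measure (Space N))] with v hv
    rw [hv]
    simpa using mul_nonneg (Real.exp_nonneg M) hB0
  have hne : ∀ t, 0 < t → t ≤ T → V t ≠ 0 := fun t ht htT h0 => by
    have := hanti (mem_Ici.2 ht.le) (mem_Ici.2 hT0.le) htT
    simp only [h0, norm_zero] at this
    exact hVT (norm_le_zero_iff.1 this)
  have hBpos : 0 < B := (norm_pos_iff.2 hVT).trans_le hB
  refine ae_abs_le_of_integral_rpow_le (h.abs_le_one T hT0) (by positivity) ?_
  filter_upwards [tendsto_natCast_atTop_atTop.eventually hcM, eventually_gt_atTop 2] with n hn hn2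
  have hn2' : (2 : ℝ) < n := by exact_mod_cast hn2
  have h1 := h.log_integral_rpow_le_of_tendsto hn2' (hc n hn2'.le) hd hd0 hLS hT hne
  have h2 : Real.log (∫ v, |V T v| ^ (n : ℝ)) ≤ (M + Real.log B) * n := by
    rw [div_le_iff₀ (by linarith)] at h1
    exact h1.trans (mul_le_mul_of_nonneg_right (by linarith) (by linarith))
  have h3 := (Real.log_le_iff_le_exp
    (integral_abs_rpow_pos hn2'.le (h.abs_le_one T hT0) hVT)).1 h2
  refine h3.trans (le_of_eq ?_)
  rw [mul_comm, Real.exp_nat_mul, Real.exp_add, Real.exp_log hBpos]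

/-- By linearity the solution is divided by `A` to reach `|V| ≤ 1`. The estimate is homogeneous, so
`A` drops out, which is essential since it is not controlled in the approximation. -/
theorem ae_abs_le_of_solution (hVc : ContinuousOn V (Ici 0))
    (hV : ∀ t, 0 < t → HasDerivAt V (-W t) t ∧ FormRel (jumpGraph J) (V t) (W t) ∧ ‖W t‖ ≤ L)
    {A : ℝ} (hA : 0 < A) (h0 : ∀ᵐ v, |V 0 v| ≤ A)
    (hc : ∀ R, 2 ≤ R → IntervalIntegrable c volume 2 R)
    (hcM : ∀ᶠ R in atTop, ∫ r in (2 : ℝ)..R, c r ≤ M) (hd : IntegrableOn d (Ioi 2))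
    (hd0 : ∀ r, 2 < r → 0 ≤ d r)
    (hLS : ∀ r, 2 < r → RealLogSobolev J r (c r * r ^ 2) (d r * r ^ 2))
    (hT : ∫ r in Ioi 2, d r < T) : ∀ᵐ v, |V T v| ≤ Real.exp M * ‖V 0‖ := by
  have hanti : AntitoneOn (fun t => ‖V t‖) (Ici 0) :=
    antitoneOn_norm_of_formRel hVc (fun t ht => (hV t ht).1) fun t ht => (hV t ht).2.1
  have hA' : 0 ≤ A⁻¹ := inv_nonneg.2 hA.le
  have hsol : IsBoundedSolution J (fun t => A⁻¹ • V t) (fun t => A⁻¹ • W t) (A⁻¹ * ‖V 0‖)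
      (A⁻¹ * L) :=
    { hasDerivAt := fun t ht => by
        rw [← smul_neg]
        exact (hV t ht).1.const_smul A⁻¹
      formRel := fun t ht => (hV t ht).2.1.smul _
      abs_le_one := fun t ht => by
        have h1 := ae_abs_le_of_formRel hA.le hVc (fun t ht => (hV t ht).1)
          (fun t ht => (hV t ht).2.1) h0 ht.le
        filter_upwards [h1, Lp.coeFn_smul A⁻¹ (V t)] with v h2 h3
        rw [h3, Pi.smul_apply, smul_eq_mul, abs_mul, abs_of_nonneg hA']
        calc A⁻¹ * |V t v| ≤ A⁻¹ * A := mul_le_mul_of_nonneg_left h2 hA'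
          _ = 1 := inv_mul_cancel₀ hA.ne'
      norm_le := fun t ht => by
        rw [norm_smul, Real.norm_of_nonneg hA']
        exact mul_le_mul_of_nonneg_left (hanti (mem_Ici.2 le_rfl) (mem_Ici.2 ht.le) ht.le) hA'
      norm_deriv_le := fun t ht => by
        rw [norm_smul, Real.norm_of_nonneg hA']
        exact mul_le_mul_of_nonneg_left (hV t ht).2.2 hA' }
  have hanti' : AntitoneOn (fun t => ‖A⁻¹ • V t‖) (Ici 0) := fun s hs t ht hst => by
    simp only [norm_smul]
    exact mul_le_mul_of_nonneg_left (hanti hs ht hst) (norm_nonneg _)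
  filter_upwards [hsol.ae_abs_le hanti' hc hcM hd hd0 hLS hT, Lp.coeFn_smul A⁻¹ (V T)] with v h1 h2
  rw [h2, Pi.smul_apply, smul_eq_mul, abs_mul, abs_of_nonneg hA'] at h1
  have h3 := mul_le_mul_of_nonneg_left h1 hA.le
  calc |V T v| = A * (A⁻¹ * |V T v|) := by field_simp
    _ ≤ _ := h3
    _ = _ := by field_simp

end SupBound

/-! ### Approximation of a mild solution by bounded strong solutions. -/

section Approximation

variable {J : Space N → Space N → ℝ}

theorem abs_sub_excess_le {M : ℝ} (hM : 0 ≤ M) (a : ℝ) :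
    |a - excess M a| ≤ M ∧ |a - excess M a| ≤ |a| := by
  unfold excess
  rcases max_cases (a - M) 0 with h1 | h1 <;> rcases min_cases (a + M) 0 with h2 | h2 <;>
  rcases abs_cases a with h3 | h3 <;> rw [h1.1, h2.1, h3.1, abs_le, abs_le] <;>
  refine ⟨⟨?_, ?_⟩, ?_, ?_⟩ <;> linarith [h1.2, h2.2, h3.2]

/-- Bounded functions are dense in the energy space for the `L²` norm. -/
theorem exists_bounded_mem_jumpGraph {f : L2 N} (hj : MemLp (jump f) 2 (jumpMeasure J)) {ξ : ℝ}
    (hξ : 0 < ξ) : ∃ (w : L2 N) (σ : Lp ℝ 2 (jumpMeasure J)) (A : ℝ), (w, σ) ∈ jumpGraph J ∧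
      0 < A ∧ (∀ᵐ v, |w v| ≤ A) ∧ ‖w‖ ≤ ‖f‖ ∧ ‖w - f‖ < ξ := by
  have hpos : ∀ n : ℕ, (0 : ℝ) ≤ (n : ℝ) + 1 := fun n => by positivity
  let e : ℕ → L2 N := fun n => (lipschitzWith_excess (hpos n)).compLp (excess_zero (hpos n)) f
  have he : ∀ n, ⇑(e n) =ᵐ[volume] fun v => excess ((n : ℝ) + 1) (f v) := fun n =>
    (lipschitzWith_excess (hpos n)).coeFn_compLp (excess_zero (hpos n)) f
  have hlim : Tendsto (fun n => ‖e n‖ ^ 2) atTop (𝓝 0) := by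
    have h1 : ∀ n, ‖e n‖ ^ 2 = ∫ v, excess ((n : ℝ) + 1) (f v) ^ 2 := fun n => by
      rw [norm_sq_eq_integral]
      refine integral_congr_ae ?_
      filter_upwards [he n] with v hv
      rw [hv]
    simp_rw [h1]
    rw [show (0 : ℝ) = ∫ _v : Space N, (0 : ℝ) by simp]
    refine tendsto_integral_of_dominated_convergence (fun v => f v ^ 2) (fun n => ?_)
      (Lp.memLp f).integrable_sq (fun n => Eventually.of_forall fun v => ?_)
      (Eventually.of_forall fun v => ?_)
    · exact (((measurable_excess _).comp_aemeasurable
        (Lp.memLp f).1.aemeasurable).pow_const 2).aestronglyMeasurable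
    · rw [Real.norm_of_nonneg (sq_nonneg _)]
      exact sq_le_sq.2 (abs_excess_le (hpos n) _)
    · refine tendsto_const_nhds.congr' ?_
      obtain ⟨m, hm⟩ := exists_nat_ge |f v|
      filter_upwards [eventually_ge_atTop m] with n hn
      have : (m : ℝ) ≤ n := by exact_mod_cast hn
      rw [(excess_eq_zero_iff (hpos n)).2 (by linarith)]
      norm_num
  obtain ⟨n, hn⟩ := (hlim.eventually_lt_const (pow_pos hξ 2)).exists
  have hej : MemLp (jump (e n)) 2 (jumpMeasure J) := by
    refine (memLp_congr_ae (jump_congr (he n))).2 ?_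
    exact memLp_jump_comp (S := univ) (K := 1) (measurable_excess _)
      (fun a _ b _ => by rw [one_mul]; exact abs_excess_sub_le (hpos n) a b) (Lp.memLp f).1
      (Eventually.of_forall fun _ => mem_univ _) hj
  have hmem := (jumpGraph J).sub_mem (toLp_mem_jumpGraph (Lp.memLp f) hj)
    (toLp_mem_jumpGraph (Lp.memLp (e n)) hej)
  rw [Lp.toLp_coeFn, Lp.toLp_coeFn] at hmem
  have hw : ∀ᵐ v, (f - e n) v = f v - excess ((n : ℝ) + 1) (f v) := by
    filter_upwards [he n, Lp.coeFn_sub f (e n)] with v h1 h2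
    rw [h2, Pi.sub_apply, h1]
  refine ⟨f - e n, _, (n : ℝ) + 1, hmem, by positivity, ?_, ?_, ?_⟩
  · filter_upwards [hw] with v hv
    rw [hv]
    exact (abs_sub_excess_le (hpos n) _).1
  · refine Lp.norm_le_norm_of_ae_le ?_
    filter_upwards [hw] with v hv
    rw [hv]
    exact (abs_sub_excess_le (hpos n) _).2
  · rw [sub_sub_cancel_left, norm_neg]
    exact lt_of_pow_lt_pow_left₀ 2 hξ.le hn

/-- Regular bounded approximations of an element of the energy space. -/
theorem exists_bounded_regular_approx {f : L2 N} (hj : MemLp (jump f) 2 (jumpMeasure J)) {ξ : ℝ}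
    (hξ : 0 < ξ) : ∃ (x y z : L2 N) (A : ℝ), FormRel (jumpGraph J) x y ∧
      FormRel (jumpGraph J) y z ∧ 0 < A ∧ (∀ᵐ v, |x v| ≤ A) ∧ ‖x‖ ≤ ‖f‖ ∧ ‖x - f‖ < ξ := by
  obtain ⟨w, σ, A, hw, hA, hwA, hwf, hwξ⟩ := exists_bounded_mem_jumpGraph hj (half_pos hξ)
  -- Chosen so that `h ‖σ‖² < (ξ/4)²`. Applying the resolvent twice moves `w` by less than `2 ·
  -- ξ/4`, and truncation costs `ξ/2`. Two applications put both `x` and its image in the domain,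
  -- and the Markov property keeps the bound `A`.
  let h : ℝ := ξ ^ 2 / (16 * (‖σ‖ ^ 2 + 1))
  have hh : 0 < h := by positivity
  obtain ⟨R, hR'⟩ := exists_resolvent (jumpGraph J) (isClosed_jumpGraph J) hh
  have hR : IsResolvent (jumpGraph J) h R := ⟨hh, hR'⟩
  have hz : FormRel (jumpGraph J) (yosida R h (R w)) (yosida R h (yosida R h w)) := by
    rw [hR.yosida_eq (hR.2 w)]
    exact hR.2 _
  have hb : ‖w - R w‖ < ξ / 4 := by
    refine lt_of_pow_lt_pow_left₀ 2 (by positivity) ((norm_resolvent_sub_sq_le hR hw).trans_lt ?_)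
    simp only [h]
    rw [div_mul_eq_mul_div, div_lt_iff₀ (by positivity)]
    nlinarith [sq_nonneg ‖σ‖, pow_pos hξ 2]
  refine ⟨R (R w), yosida R h (R w), _, A, hR.2 _, hz, hA,
    hR.abs_apply_le hA.le (hR.abs_apply_le hA.le hwA),
    (norm_resolvent_le hR _).trans ((norm_resolvent_le hR _).trans hwf), ?_⟩
  have e1 : R (R w) - f = -R (w - R w) - (w - R w) + (w - f) := by
    rw [map_sub]; abel
  rw [e1]
  refine (norm_add_le _ _).trans_lt ?_
  have e2 := norm_sub_le (-R (w - R w)) (w - R w)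
  rw [norm_neg] at e2
  linarith [norm_resolvent_le hR (w - R w)]

theorem IsMildSolution.formRel (hJ : IsLevyKernel J) {u₀ : L2 N} {u : ℝ → L2 N}
    (hu : IsMildSolution J u₀ u) {t : ℝ} (ht : 0 < t) :
    FormRel (jumpGraph J) (u t) (-deriv u t) := by
  have hj := ((memEnergySpace_iff hJ).1 (hu.mem_energySpace t ht)).2
  have hmem := toLp_mem_jumpGraph (Lp.memLp (u t)) hj
  rw [Lp.toLp_coeFn] at hmem
  refine ⟨_, hmem, fun z hz => ?_⟩
  have hzj := memLp_jump_of_mem hz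
  have h1 := hu.equation t ht z.1 ((memEnergySpace_iff hJ).2 ⟨Lp.memLp z.1, hzj⟩)
  rw [dirichletForm_eq_integral hJ hj hzj, ← EReal.coe_add, ← EReal.coe_zero,
    EReal.coe_eq_coe_iff] at h1
  have h2 : ∫ w, hj.toLp (jump (u t)) w * z.2 w ∂jumpMeasure J
      = ∫ w, jump (u t) w * jump z.1 w ∂jumpMeasure J := integral_congr_ae <| by
    filter_upwards [hj.coeFn_toLp, mem_jumpGraph.1 hz] with w e1 e2
    rw [e1, e2]
  rw [inner_neg_left, inner_eq_integral (hj.toLp _), h2]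
  linarith

theorem IsMildSolution.hasDerivAt {u₀ : L2 N} {u : ℝ → L2 N} (hu : IsMildSolution J u₀ u) {t : ℝ}
    (ht : 0 < t) : HasDerivAt u (deriv u t) t :=
  ((hu.contDiffOn.differentiableOn one_ne_zero).differentiableAt (Ioi_mem_nhds ht)).hasDerivAt

theorem IsMildSolution.norm_le (hJ : IsLevyKernel J) {u₀ : L2 N} {u : ℝ → L2 N}
    (hu : IsMildSolution J u₀ u) {t : ℝ} (ht : 0 ≤ t) : ‖u t‖ ≤ ‖u₀‖ := by
  have h1 := antitoneOn_norm_of_formRel (Γ := jumpGraph J) (w := fun t => -deriv u t)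
    hu.continuousOn (fun t ht => by rw [neg_neg]; exact hu.hasDerivAt ht)
    (fun t ht => hu.formRel hJ ht) (mem_Ici.2 le_rfl) (mem_Ici.2 ht) ht
  simpa only [hu.initial] using h1

/-- The delay `δ` puts the starting value in the energy space, where bounded regular approximations
exist. Contractivity carries their `L²` closeness to time `T`, and a subsequence converging almost
everywhere inherits the uniform bound. -/
theorem IsMildSolution.ae_abs_le (hJ : IsLevyKernel J) {u₀ : L2 N} {u : ℝ → L2 N}
    (hu : IsMildSolution J u₀ u) {c d : ℝ → ℝ} {M T : ℝ}
    (hc : ∀ R, 2 ≤ R → IntervalIntegrable c volume 2 R)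
    (hcM : ∀ᶠ R in atTop, ∫ r in (2 : ℝ)..R, c r ≤ M) (hd : IntegrableOn d (Ioi 2))
    (hd0 : ∀ r, 2 < r → 0 ≤ d r)
    (hLS : ∀ r, 2 < r → RealLogSobolev J r (c r * r ^ 2) (d r * r ^ 2))
    (hT : ∫ r in Ioi 2, d r < T) {δ : ℝ} (hδ : 0 < δ) :
    ∀ᵐ v, |u (δ + T) v| ≤ Real.exp M * ‖u₀‖ := by
  have hT0 : 0 < T := (setIntegral_nonneg measurableSet_Ioi hd0).trans_lt hT
  have hj := ((memEnergySpace_iff hJ).1 (hu.mem_energySpace δ hδ)).2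
  have happ : ∀ n : ℕ, ∃ g : L2 N, ‖g - u (δ + T)‖ < 1 / ((n : ℝ) + 1) ∧
      ∀ᵐ v, |g v| ≤ Real.exp M * ‖u₀‖ := by
    intro n
    obtain ⟨x, y, z, A, hxy, hyz, hA, hxA, hxf, hxξ⟩ :=
      exists_bounded_regular_approx hj (Nat.one_div_pos_of_nat (α := ℝ) (n := n))
    obtain ⟨V, W, hV0, hVc, hV⟩ := exists_solution (isClosed_jumpGraph J) hxy hyz
    refine ⟨V T, ?_, ?_⟩
    · have h1 := antitoneOn_norm_of_formRel (Γ := jumpGraph J) (v := fun t => V t - u (δ + t))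
        (w := fun t => W t - -deriv u (δ + t))
        (hVc.sub (hu.continuousOn.comp (by fun_prop) fun t ht =>
          add_nonneg hδ.le (mem_Ici.1 ht)))
        (fun t ht => by
          have h2 := (hV t ht).1.sub ((hu.hasDerivAt (add_pos hδ ht)).comp_const_add δ t)
          rwa [show -(W t - -deriv u (δ + t)) = -W t - deriv u (δ + t) by abel])
        (fun t ht => (hV t ht).2.1.sub (hu.formRel hJ (add_pos hδ ht)))
        (mem_Ici.2 le_rfl) (mem_Ici.2 hT0.le) hT0.le
      simp only [add_zero, hV0] at h1
      exact h1.trans_lt hxξ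
    · have h1 := ae_abs_le_of_solution hVc hV hA (by rwa [hV0]) hc hcM hd hd0 hLS hT
      rw [hV0] at h1
      filter_upwards [h1] with v hv
      exact hv.trans (mul_le_mul_of_nonneg_left (hxf.trans (hu.norm_le hJ hδ.le))
        (Real.exp_nonneg _))
  choose g hg1 hg2 using happ
  have hlim : Tendsto g atTop (𝓝 (u (δ + T))) := by
    rw [tendsto_iff_norm_sub_tendsto_zero]
    exact squeeze_zero (fun _ => norm_nonneg _) (fun n => (hg1 n).le)
      tendsto_one_div_add_atTop_nhds_zero_nat
  obtain ⟨ns, -, hns⟩ := exists_seq_tendsto_ae_Lp hlim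
  filter_upwards [hns, ae_all_iff.2 hg2] with v h1 h2
  exact le_of_tendsto h1.abs (Eventually.of_forall fun i => h2 (ns i))

end Approximation

end LevyOp

end

/-! ### Assembly of the main theorem. -/

theorem mainTheorem4 {N : ℕ} (J : LevyOp.Space N → LevyOp.Space N → ℝ)
    (hJ : LevyOp.IsLevyKernel J) (p : ℝ) (hp : 2 ≤ p) (C D : ℝ → ℝ)
    (hLS : ∀ r, p ≤ r → LevyOp.LogSobolev J r (C r) (D r))
    (hD : MeasureTheory.IntegrableOn (fun α => D α / α ^ 2) (Set.Ioi p))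
    (hC : ∀ R, p ≤ R →
      IntervalIntegrable (fun α => C α / α ^ 2) MeasureTheory.volume p R)
    (hC' : ∃ M : ℝ, ∀ R, p ≤ R → ∫ α in p..R, C α / α ^ 2 ≤ M) :
    LevyOp.EventuallyUltracontractive J := by
  obtain ⟨M, hM⟩ := hC'
  have hconst : ∀ (k : ℝ) {a b : ℝ}, 2 ≤ a → a ≤ b →
      IntervalIntegrable (fun α => k / α ^ 2) MeasureTheory.volume a b := fun k a b ha hab => by
    refine ContinuousOn.intervalIntegrable ?_
    rw [Set.uIcc_of_le hab]
    exact continuousOn_const.div (by fun_prop) fun x hx => by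
      have : 0 < x := by linarith [hx.1]
      positivity
  -- Below `p` the constants are those of order `p`, with the factor `p²/4` lost in lowering the
  -- order.
  let c : ℝ → ℝ := fun r => if r ≤ p then C p / r ^ 2 else C r / r ^ 2
  let d : ℝ → ℝ := fun r => if r ≤ p then D p * (p ^ 2 / 4) / r ^ 2 else D r / r ^ 2
  have hcle : ∀ r, r ≤ p → c r = C p / r ^ 2 := fun r hr => if_pos hr
  have hcgt : ∀ r, p < r → c r = C r / r ^ 2 := fun r hr => if_neg hr.not_ge
  have hdle : ∀ r, r ≤ p → d r = D p * (p ^ 2 / 4) / r ^ 2 := fun r hr => if_pos hr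
  have hdgt : ∀ r, p < r → d r = D r / r ^ 2 := fun r hr => if_neg hr.not_ge
  have hc1 : ∀ R, 2 ≤ R → R ≤ p → IntervalIntegrable c MeasureTheory.volume 2 R :=
    fun R hR hRp => (hconst (C p) le_rfl hR).congr fun x hx => by
      rw [Set.uIoc_of_le hR] at hx
      exact (hcle x (hx.2.trans hRp)).symm
  have hc2 : ∀ R, p ≤ R → IntervalIntegrable c MeasureTheory.volume p R := fun R hR =>
    (hC R hR).congr fun x hx => by
      rw [Set.uIoc_of_le hR] at hx
      exact (hcgt x hx.1).symm
  have hc : ∀ R, 2 ≤ R → IntervalIntegrable c MeasureTheory.volume 2 R := fun R hR => by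
    rcases le_total R p with h | h
    · exact hc1 R hR h
    · exact (hc1 p hp le_rfl).trans (hc2 R h)
  have hcM : ∀ᶠ R in Filter.atTop, ∫ r in (2 : ℝ)..R, c r ≤ (∫ r in (2 : ℝ)..p, c r) + M := by
    filter_upwards [Filter.eventually_ge_atTop p] with R hR
    rw [← intervalIntegral.integral_add_adjacent_intervals (hc1 p hp le_rfl) (hc2 R hR)]
    refine add_le_add le_rfl (le_trans (le_of_eq ?_) (hM R hR))
    refine intervalIntegral.integral_congr_ae (Filter.Eventually.of_forall fun x hx => ?_)
    rw [Set.uIoc_of_le hR] at hx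
    exact hcgt x hx.1
  have hd : MeasureTheory.IntegrableOn d (Set.Ioi 2) := by
    rw [← Set.Ioc_union_Ioi_eq_Ioi hp]
    refine MeasureTheory.IntegrableOn.union ?_ ?_
    · have := (intervalIntegrable_iff_integrableOn_Ioc_of_le hp).1
        (hconst (D p * (p ^ 2 / 4)) le_rfl hp)
      exact this.congr_fun (fun x hx => (hdle x hx.2).symm) measurableSet_Ioc
    · exact hD.congr_fun (fun x hx => (hdgt x hx).symm) measurableSet_Ioi
  have hd0 : ∀ r, 2 < r → 0 ≤ d r := fun r hr => by
    rcases le_or_gt r p with h | h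
    · rw [hdle r h]
      have := (hLS p le_rfl).1
      positivity
    · rw [hdgt r h]
      have := (hLS r h.le).1
      positivity
  have hreal : ∀ r, 2 < r → LevyOp.RealLogSobolev J r (c r * r ^ 2) (d r * r ^ 2) := fun r hr => by
    have hr0 : r ^ 2 ≠ 0 := by positivity
    rcases le_or_gt r p with h | h
    · rw [hcle r h, hdle r h, div_mul_cancel₀ _ hr0, div_mul_cancel₀ _ hr0]
      exact (hLS p le_rfl).real_of_le hJ hr h
    · rw [hcgt r h, hdgt r h, div_mul_cancel₀ _ hr0, div_mul_cancel₀ _ hr0]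
      exact (hLS r h.le).real hJ hr
  have hI : 0 ≤ ∫ r in Set.Ioi 2, d r := MeasureTheory.setIntegral_nonneg measurableSet_Ioi hd0
  -- The extra unit of time leaves `1/2` for entering the energy space and keeps `t - 1/2` strictly
  -- above the integral of `d`. The resulting bound does not depend on `t`.
  refine ⟨(∫ r in Set.Ioi 2, d r) + 1, by linarith,
    fun _ => (Real.exp ((∫ r in (2 : ℝ)..p, c r) + M)).toNNReal, fun u₀ u hu t ht => ?_⟩
  have h1 := hu.ae_abs_le hJ hc hcM hd hd0 hreal (T := t - 1 / 2) (by linarith)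
    (δ := 1 / 2) (by norm_num)
  rw [add_sub_cancel] at h1
  rw [MeasureTheory.eLpNorm_exponent_top]
  refine (MeasureTheory.eLpNormEssSup_le_of_ae_bound h1).trans (le_of_eq ?_)
  rw [ENNReal.ofReal_mul (Real.exp_nonneg _), MeasureTheory.Lp.norm_def,
    ENNReal.ofReal_toReal (MeasureTheory.Lp.eLpNorm_ne_top u₀), ENNReal.ofReal]
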